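/- Let $d\ge 2$, let $V$ be a finite non-empty vertex set and $n=|V|$. Put $S_e(n,d)=dn-\binom{d+1}{2}$ if $n\ge d+1$ and $S_e(n,d)=\binom n2$ if $n\le d$, and $S(n,d)=S_e(n,d)+n-1$. A configuration of points $x_u\in\mathbb R^d$ $(u\in V)$ is generic if its $dn$ coordinates are not a root of any nonzero polynomial with integer coefficients. A simple undirected graph $G$ on $V$ (a Euclidean graph) is rigid in $\mathbb R^d$ if for every generic $x$ the matrix of the linear system $(x_u-x_w)^\intercal(v_u-v_w)=0$, $uw\in E(G)$, in the unknowns $v_u\in\mathbb R^d$, has rank $S_e(n,d)$. A conic graph $\tilde\Gamma=(V,E_S,E_D)$ is a loopless undirected multigraph with simple edges $E_S$ and double edges $E_D$; it has $|E_S|+2|E_D|$ edges. It is the conic graph of a simple directed graph $\Gamma$ on $V$ if it is the underlying undirected multigraph of $\Gamma$. The conic rigidity matrix $M(\Gamma,p)$, where $p(u)=(x_u,\beta_u)\in\mathbb R^{d}\times\mathbb R$, is the matrix of the linear system $(x_u-x_w)^\intercal(v_u-v_w)+\|x_u-x_w\|(\alpha_w-\alpha_u)=0$, one equation for every arc $uw$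 of $\Gamma$, in the unknowns $(v_u,\alpha_u)\in\mathbb R^d\times\mathbb R$. $\tilde\Gamma$ is rigid (respectively independent) in $\mathbb R^d$ if for all $\Gamma$ whose conic graph is $\tilde\Gamma$ and all $p$ with $x$ generic, $M(\Gamma,p)$ has rank $S(n,d)$ (respectively linearly independent rows). $\tilde\Gamma$ is minimally rigid in $\mathbb R^d$ if it is rigid in $\mathbb R^d$ and no conic graph obtained from it by removing at least one edge (possibly only one of the two copies of a double edge) is rigid in $\mathbb R^d$. A decomposition of $\tilde\Gamma$ is a pair $(G,H)$ of simple undirected graphs on $V$ with $E_S=E(G)\triangle E(H)$ and $E_D=E(G)\cap E(H)$. Then: (1) $\tilde\Gamma$ is rigid in $\mathbb R^d$ if and only if it has a decomposition $(G,H)$ such that $G$ is rigid in $\mathbb R^d$ and $H$ is connected. (2) $\tilde\Gamma$ is minimally rigid in $\mathbb R^d$ if and only if it is independent in $\mathbb R^d$ and has exactly $S_e(n,d)+n-1$ edges. In particular, minimally rigid conic graphs have $S_e(n,d)+n-1$ edges. -/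

import Mathlib

open scoped symmDiff

/-- A simple directed graph: no loops, at most one arc from a vertex to another one
(the two opposite arcs `uw` and `wu` may both be present). -/
structure SimpleDigraph (V : Type*) extends Digraph V where
  loopless : ∀ u, ¬ Adj u u

/-- A conic graph: an undirected multigraph without loops whose edges are simple or double.
`simple` carries the set of simple edges and `double` the set of double edges. -/
@[ext]
structure ConicGraph (V : Type*) where
  simple : SimpleGraph V
  double : SimpleGraph V
  disjoint : Disjoint simple double

/-- The set of arcs of a simple directed graph. -/
def SimpleDigraph.arcSet {V : Type*} (Γ : SimpleDigraph V) : Set (V × V) :=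
  {a | Γ.Adj a.1 a.2}

/-- The conic graph of a simple directed graph: its underlying undirected multigraph. -/
def SimpleDigraph.conicGraph {V : Type*} (Γ : SimpleDigraph V) : ConicGraph V where
  simple :=
    { Adj := fun u w => (Γ.Adj u w ∧ ¬ Γ.Adj w u) ∨ (Γ.Adj w u ∧ ¬ Γ.Adj u w)
      symm := ⟨fun _ _ h => h.symm⟩
      loopless := ⟨fun u h => h.elim (fun h => Γ.loopless u h.1) (fun h => Γ.loopless u h.1)⟩ }
  double :=
    { Adj := fun u w => Γ.Adj u w ∧ Γ.Adj w u
      symm := ⟨fun _ _ h => h.symm⟩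
      loopless := ⟨fun u h => Γ.loopless u h.1⟩ }
  disjoint := by
    rw [SimpleGraph.disjoint_left]
    rintro u w (h | h) h'
    · exact h.2 h'.2
    · exact h.2 h'.1

/-- The union of two Euclidean graphs (simple undirected graphs) on the same vertex set: the
conic graph whose simple edges form the symmetric difference of the edge sets and whose double
edges form their intersection. -/
def ConicGraph.union {V : Type*} (G H : SimpleGraph V) : ConicGraph V where
  simple := G ∆ H
  double := G ⊓ H
  disjoint := disjoint_symmDiff_inf G H

/-- `(G, H)` is a decomposition of the conic graph `T`. -/
def ConicGraph.IsDecomposition {V : Type*} (T : ConicGraph V) (G H : SimpleGraph V) : Prop :=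
  T = ConicGraph.union G H

/-- The number of edges of a conic graph, double edges being counted twice. -/
noncomputable def ConicGraph.numEdges {V : Type*} (T : ConicGraph V) : ℕ :=
  T.simple.edgeSet.ncard + 2 * T.double.edgeSet.ncard

/-- `T'` is a spanning subgraph of `T` as a multigraph: the multiplicity in `T'` of every pair of
vertices is at most its multiplicity in `T`. -/
def ConicGraph.IsSubgraph {V : Type*} (T' T : ConicGraph V) : Prop :=
  T'.simple ⊔ T'.double ≤ T.simple ⊔ T.double ∧ T'.double ≤ T.double

/-- The spatial part of a configuration: `p u = (x_u, β_u)`. -/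
def spatial {V : Type*} {d : ℕ} (p : V → EuclideanSpace ℝ (Fin d) × ℝ) :
    V → EuclideanSpace ℝ (Fin d) :=
  fun u => (p u).1

/-- The points `x_u` are in generic position: their coordinates are not a root of any nonzero
polynomial with integer coefficients. -/
def IsGeneric {V : Type*} {d : ℕ} (x : V → EuclideanSpace ℝ (Fin d)) : Prop :=
  ∀ P : MvPolynomial (V × Fin d) ℤ, MvPolynomial.aeval (fun c : V × Fin d => x c.1 c.2) P = 0 → P = 0

/-- The entries of the row of an edge `uw` in the Euclidean rigidity matrix: the block of `u` is
`x_u - x_w`, the block of `w` is `x_w - x_u`, and the other blocks are zero. -/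
noncomputable def euclideanRow {V : Type*} [DecidableEq V] {d : ℕ}
    (x : V → EuclideanSpace ℝ (Fin d)) (u w : V) (c : V × Fin d) : ℝ :=
  if c.1 = u then x u c.2 - x w c.2 else if c.1 = w then x w c.2 - x u c.2 else 0

theorem euclideanRow_comm {V : Type*} [DecidableEq V] {d : ℕ}
    (x : V → EuclideanSpace ℝ (Fin d)) (u w : V) : euclideanRow x u w = euclideanRow x w u := by
  funext c
  unfold euclideanRow
  split_ifs with hu hw
  · rw [← hu, ← hw]
  all_goals rfl

/-- The Euclidean rigidity matrix of a Euclidean framework, one row per (undirected) edge. -/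
noncomputable def euclideanRigidityMatrix {V : Type*} [DecidableEq V] {d : ℕ}
    (G : SimpleGraph V) (x : V → EuclideanSpace ℝ (Fin d)) : Matrix G.edgeSet (V × Fin d) ℝ :=
  Matrix.of fun e => Sym2.lift ⟨euclideanRow x, euclideanRow_comm x⟩ e.1

/-- The entries of the row of an arc `uw` in the bias block of the conic rigidity matrix: the
entry of `u` is `-‖x_u - x_w‖`, the entry of `w` is `‖x_u - x_w‖`, the other entries are zero. -/
noncomputable def biasRow {V : Type*} [DecidableEq V] {d : ℕ}
    (x : V → EuclideanSpace ℝ (Fin d)) (u w : V) (c : V) : ℝ :=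
  if c = u then -‖x u - x w‖ else if c = w then ‖x u - x w‖ else 0

/-- The conic rigidity matrix of the conic framework `(Γ, p)`: one row per arc, a spatial block
and a bias block. It is the matrix of the linear system
`⟪x_u - x_w, v_u - v_w⟫ + ‖x_u - x_w‖ * (α_w - α_u) = 0` for the arcs `uw`. -/
noncomputable def conicRigidityMatrix {V : Type*} [DecidableEq V] {d : ℕ}
    (Γ : SimpleDigraph V) (p : V → EuclideanSpace ℝ (Fin d) × ℝ) :
    Matrix Γ.arcSet ((V × Fin d) ⊕ V) ℝ :=
  Matrix.fromCols
    (Matrix.of fun a => euclideanRow (spatial p) a.1.1 a.1.2)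
    (Matrix.of fun a => biasRow (spatial p) a.1.1 a.1.2)

/-- The maximal rank `S_e(n, d)` of the Euclidean rigidity matrix. -/
def maxEuclideanRank (n d : ℕ) : ℕ :=
  if d + 1 ≤ n then d * n - (d + 1).choose 2 else n.choose 2

/-- The bound `S(n, d) = S_e(n, d) + n - 1` on the rank of the conic rigidity matrix (used with
at least one vertex). -/
def maxConicRank (n d : ℕ) : ℕ :=
  maxEuclideanRank n d + n - 1

/-- Infinitesimal rigidity of the `d`-dimensional Euclidean framework `(G, x)`. -/
def IsInfinitesimallyRigidEuclidean {V : Type*} [Fintype V] [DecidableEq V] {d : ℕ}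
    (G : SimpleGraph V) (x : V → EuclideanSpace ℝ (Fin d)) : Prop :=
  (euclideanRigidityMatrix G x).rank = maxEuclideanRank (Fintype.card V) d

/-- Infinitesimal rigidity of the `d`-dimensional conic framework `(Γ, p)`. -/
def IsInfinitesimallyRigidConic {V : Type*} [Fintype V] [DecidableEq V] {d : ℕ}
    (Γ : SimpleDigraph V) (p : V → EuclideanSpace ℝ (Fin d) × ℝ) : Prop :=
  (conicRigidityMatrix Γ p).rank = maxConicRank (Fintype.card V) d

/-- A Euclidean graph is rigid in `ℝ^d` if its generic frameworks are infinitesimally rigid. -/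
def IsRigidEuclidean {V : Type*} [Fintype V] [DecidableEq V] (d : ℕ) (G : SimpleGraph V) : Prop :=
  ∀ x : V → EuclideanSpace ℝ (Fin d), IsGeneric x → IsInfinitesimallyRigidEuclidean G x

/-- A conic graph is rigid in `ℝ^d` if every generic conic framework `(Γ, p)` whose conic graph
is the given one is infinitesimally rigid. -/
def ConicGraph.IsRigid {V : Type*} [Fintype V] [DecidableEq V] (d : ℕ) (T : ConicGraph V) : Prop :=
  ∀ (Γ : SimpleDigraph V) (p : V → EuclideanSpace ℝ (Fin d) × ℝ),
    Γ.conicGraph = T → IsGeneric (spatial p) → IsInfinitesimallyRigidConic Γ p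

/-- A conic graph is independent in `ℝ^d` if the rows of the conic rigidity matrix of every
generic conic framework whose conic graph is the given one are linearly independent. -/
def ConicGraph.IsIndependent {V : Type*} [DecidableEq V] (d : ℕ) (T : ConicGraph V) :
    Prop :=
  ∀ (Γ : SimpleDigraph V) (p : V → EuclideanSpace ℝ (Fin d) × ℝ),
    Γ.conicGraph = T → IsGeneric (spatial p) → LinearIndependent ℝ (conicRigidityMatrix Γ p).row

/-- A conic graph is minimally rigid in `ℝ^d` if it is rigid and no longer so once some of its
edges are removed (one or both copies in the case of a double edge). -/
def ConicGraph.IsMinimallyRigid {V : Type*} [Fintype V] [DecidableEq V] (d : ℕ)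
    (T : ConicGraph V) : Prop :=
  T.IsRigid d ∧ ∀ T' : ConicGraph V, T'.IsSubgraph T → T'.IsRigid d → T' = T

/-! The conic row of an arc is its Euclidean row plus its length times its signed incidence row, the
two living in disjoint blocks of columns. The rank is therefore at most `maxEuclideanRank` plus
$n-1$, and generic conic rigidity behaves like the union of the Euclidean rigidity matroid and the
graphic matroid.

If the bound is attained, expand a nonzero maximal minor multilinearly
(`LinearIndependent.exists_piecewise_of_add_smul`): some term is nonzero, so the basis arcs split
into independent Euclidean rows and independent incidence rows. By counting, both parts have full
size, which yields $G$ and $H$.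

Conversely, a nonzero term of the expansion must not be cancelled by the others. The lengths are
functions of the generic coordinates, so this is not automatic: it holds because square-free
products of distinct lengths are linearly independent over $\mathbb Z[x]$
(`IsGeneric.sum_mul_prod_dist_eq_zero`), a Kummer-type statement resting on `prod_sqDistPoly_ne_sq`.
The two arcs of a double edge share one length, but their rows span the Euclidean and the incidence
row separately, so they need no weight.

For (2), a row basis of a rigid framework is a subgraph rigid at one generic framework, hence
decomposable by the first half and rigid by the second. Minimal graphs thus have as many edges as
the rank. -/

/-- Infinitely many real numbers are algebraically independent, so generic configurations exist. -/
theorem exists_isGeneric (V : Type*) [Finite V] (d : ℕ) :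
    ∃ x : V → EuclideanSpace ℝ (Fin d), IsGeneric x := by
  obtain ⟨s, hs⟩ := exists_isTranscendenceBasis ℤ ℝ
  -- Were $s$ finite, $\mathbb R$ would be algebraic over the countable ring $\mathbb Z[s]$, hence
  -- countable.
  have hinf : Infinite s := by
    by_contra hfin
    rw [not_infinite_iff_finite] at hfin
    have halg : Algebra.IsAlgebraic (Algebra.adjoin ℤ s) ℝ := by
      have := hs.isAlgebraic
      rwa [Subtype.range_coe] at this
    have hcount : Countable (Algebra.adjoin ℤ s) := by
      have : Countable (MvPolynomial s ℤ) := by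
        rw [← Cardinal.mk_le_aleph0_iff]
        exact MvPolynomial.cardinalMk_le_max_lift.trans (by simp)
      have h := (MvPolynomial.aeval (R := ℤ) (fun c : s => (c : ℝ))).toRingHom.rangeRestrict_surjective
      have h2 : (Algebra.adjoin ℤ s) = (MvPolynomial.aeval (R := ℤ) (fun c : s => (c : ℝ))).range := by
        rw [← Algebra.adjoin_range_eq_range_aeval, Subtype.range_coe]
      rw [h2]
      exact h.countable
    have h1 := Algebra.IsAlgebraic.cardinalMk_le_max (Algebra.adjoin ℤ s) ℝ
    rw [Cardinal.mk_real] at h1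
    have h2 : max (Cardinal.mk (Algebra.adjoin ℤ s)) Cardinal.aleph0 = Cardinal.aleph0 :=
      max_eq_right (Cardinal.mk_le_aleph0)
    rw [h2] at h1
    exact absurd Cardinal.aleph0_lt_continuum (not_lt.2 h1)
  have := Fintype.ofFinite V
  let f : V × Fin d ↪ s :=
    (Fintype.equivFin _).toEmbedding.trans (Fin.valEmbedding.trans (Infinite.natEmbedding s))
  refine ⟨fun u => WithLp.toLp 2 fun i => (f (u, i) : ℝ), fun P hP => ?_⟩
  have hind : AlgebraicIndependent ℤ (fun c : V × Fin d => (f c : ℝ)) := hs.1.comp f f.injective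
  exact (injective_iff_map_eq_zero _).1 hind P hP

/-! ### Linear independence of products of distances -/

/-- The subring generated by the coordinates of a configuration. -/
noncomputable def coordRing {V : Type*} {d : ℕ} (x : V → EuclideanSpace ℝ (Fin d)) : Subring ℝ :=
  (MvPolynomial.aeval (R := ℤ) fun c : V × Fin d => x c.1 c.2).toRingHom.range

theorem mem_coordRing {V : Type*} {d : ℕ} {x : V → EuclideanSpace ℝ (Fin d)} {r : ℝ} :
    r ∈ coordRing x ↔
      ∃ P : MvPolynomial (V × Fin d) ℤ, MvPolynomial.aeval (fun c => x c.1 c.2) P = r :=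
  Iff.rfl

/-- The elements `a + b * t` for `a`, `b` in a subring containing `t ^ 2`. -/
def Subring.adjoinSqrt {L : Type*} [CommRing L] (R : Subring L) (t : L) (ht : t ^ 2 ∈ R) :
    Subring L where
  carrier := {r | ∃ a ∈ R, ∃ b ∈ R, r = a + b * t}
  mul_mem' := by
    rintro _ _ ⟨a, ha, b, hb, rfl⟩ ⟨a', ha', b', hb', rfl⟩
    exact ⟨a * a' + b * b' * t ^ 2, R.add_mem (R.mul_mem ha ha') (R.mul_mem (R.mul_mem hb hb') ht),
      a * b' + b * a', R.add_mem (R.mul_mem ha hb') (R.mul_mem hb ha'), by ring⟩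
  one_mem' := ⟨1, R.one_mem, 0, R.zero_mem, by ring⟩
  add_mem' := by
    rintro _ _ ⟨a, ha, b, hb, rfl⟩ ⟨a', ha', b', hb', rfl⟩
    exact ⟨a + a', R.add_mem ha ha', b + b', R.add_mem hb hb', by ring⟩
  zero_mem' := ⟨0, R.zero_mem, 0, R.zero_mem, by ring⟩
  neg_mem' := by
    rintro _ ⟨a, ha, b, hb, rfl⟩
    exact ⟨-a, R.neg_mem ha, -b, R.neg_mem hb, by ring⟩

/-- If no nonempty product of the elements `t i ^ 2` of `R` is a square in the fraction field
of `R`, then the products of distinct elements `t i` are linearly independent over `R`. -/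
theorem sum_mul_prod_sqrt_eq_zero {L : Type*} [Field L] [CharZero L] {ι : Type*} [DecidableEq ι]
    (t : ι → L) (D : Finset ι) : ∀ R : Subring L, (∀ i ∈ D, t i ^ 2 ∈ R) →
    (∀ S ⊆ D, S.Nonempty → ∀ a ∈ R, ∀ b ∈ R, (∏ i ∈ S, t i ^ 2) * b ^ 2 = a ^ 2 → b = 0) →
    ∀ c : Finset ι → L, (∀ S, c S ∈ R) → ∑ S ∈ D.powerset, c S * ∏ i ∈ S, t i = 0 →
    ∀ S ⊆ D, c S = 0 := by
  induction D using Finset.induction_on with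
  | empty =>
    intro R _ _ c _ hsum S hS
    simpa [Finset.subset_empty.1 hS] using hsum
  | insert e D he ih =>
    intro R hR hsq c hc hsum
    have hq := hR e (Finset.mem_insert_self e D)
    have hsing : ∀ a ∈ R, ∀ b ∈ R, t e ^ 2 * b ^ 2 = a ^ 2 → b = 0 := fun a ha b hb h =>
      hsq {e} (by simp) (by simp) a ha b hb (by simpa using h)
    have hlin : ∀ a ∈ R, ∀ b ∈ R, a + b * t e = 0 → a = 0 ∧ b = 0 := by
      intro a ha b hb h
      have hb0 := hsing a ha b hb (by linear_combination (b * t e - a) * h)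
      subst hb0
      simpa using h
    -- Induct over the enlarged ring $R[t_e]$; the work lies in showing that the products of squares
    -- remain non-squares there.
    have key := ih (R.adjoinSqrt (t e) hq)
      (fun i hi => ⟨_, hR i (Finset.mem_insert_of_mem hi), 0, R.zero_mem, by ring⟩)
      (by
        rintro S hS hSne _ ⟨a, ha, b, hb, rfl⟩ _ ⟨c, hc, d, hd, rfl⟩ h
        have heS : e ∉ S := fun h => he (hS h)
        set Q := ∏ i ∈ S, t i ^ 2 with hQ
        have hQR : Q ∈ R := R.prod_mem fun i hi => hR i (Finset.mem_insert_of_mem (hS hi))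
        have h2R : (2 : L) ∈ R := ofNat_mem R 2
        set q := t e ^ 2 with hqdef
        have hA : a * c - b * d * q ∈ R :=
          R.sub_mem (R.mul_mem ha hc) (R.mul_mem (R.mul_mem hb hd) hq)
        have hB : b * c - a * d ∈ R := R.sub_mem (R.mul_mem hb hc) (R.mul_mem ha hd)
        have hN : c ^ 2 - d ^ 2 * q ∈ R :=
          R.sub_mem (R.pow_mem hc 2) (R.mul_mem (R.pow_mem hd 2) hq)
        -- Multiply $Q(c+dt_e)^2=(a+bt_e)^2$ by the conjugate $(c-dt_e)^2$ and compare the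
        -- coefficients of $1$ and $t_e$. The latter gives $2(ac-bdq)(bc-ad)=0$; either factor
        -- vanishing makes $Qq$ or $Q$ a square unless the norm $c^2-d^2q$ is zero.
        have hrel := hlin
          (Q * (c ^ 2 - d ^ 2 * q) ^ 2 - (a * c - b * d * q) ^ 2 - (b * c - a * d) ^ 2 * q)
          (R.sub_mem (R.sub_mem (R.mul_mem hQR (R.pow_mem hN 2)) (R.pow_mem hA 2))
            (R.mul_mem (R.pow_mem hB 2) hq))
          (-2 * ((a * c - b * d * q) * (b * c - a * d)))
          (R.mul_mem (R.neg_mem h2R) (R.mul_mem hA hB))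
          (by rw [hqdef]; linear_combination (c - d * t e) ^ 2 * h)
        have hN0 : c ^ 2 - d ^ 2 * q = 0 := by
          have h0 : (a * c - b * d * q) * (b * c - a * d) = 0 := by
            rcases mul_eq_zero.1 hrel.2 with h | h
            · norm_num at h
            · exact h
          rcases mul_eq_zero.1 h0 with h1 | h1
          · refine hsq (insert e S) (Finset.insert_subset_insert e hS) (by simp)
              ((b * c - a * d) * q) (R.mul_mem hB hq) _ hN ?_
            rw [Finset.prod_insert heS, ← hQ, ← hqdef]
            have := hrel.1
            rw [h1] at this
            linear_combination q * this
          · refine hsq S (hS.trans (Finset.subset_insert e D)) hSne _ hA _ hN ?_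
            have := hrel.1
            rw [h1] at this
            linear_combination this
        have hd0 := hsing c hc d hd (by linear_combination -hN0)
        subst hd0
        simpa using hN0)
      -- Each subset avoiding $e$ is paired with its union with $e$.
      (fun S => c S + c (insert e S) * t e) (fun S => ⟨_, hc _, _, hc _, rfl⟩)
      (by
        rw [Finset.sum_powerset_insert he, ← Finset.sum_add_distrib] at hsum
        rw [← hsum]
        refine Finset.sum_congr rfl fun S hS => ?_
        rw [Finset.prod_insert fun h => he (Finset.mem_powerset.1 hS h)]
        ring)
    intro S hS
    by_cases heS : e ∈ S
    · have h := (hlin _ (hc _) _ (hc _)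
        (key (S.erase e) (by rwa [← Finset.subset_insert_iff]))).2
      rwa [Finset.insert_erase heS] at h
    · exact (hlin _ (hc _) _ (hc _)
        (key S ((Finset.subset_insert_iff_of_notMem heS).1 hS))).1

/-- The squared distance of two points, as a polynomial in the coordinates. -/
noncomputable def sqDistPoly {V : Type*} (d : ℕ) (u w : V) : MvPolynomial (V × Fin d) ℤ :=
  ∑ i, (MvPolynomial.X (u, i) - MvPolynomial.X (w, i)) ^ 2

theorem aeval_sqDistPoly {V : Type*} {d : ℕ} (x : V → EuclideanSpace ℝ (Fin d)) (u w : V) :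
    MvPolynomial.aeval (fun c => x c.1 c.2) (sqDistPoly d u w) = ‖x u - x w‖ ^ 2 := by
  simp [sqDistPoly, EuclideanSpace.norm_sq_eq]

/-- A nonempty product of distinct squared distances is not the square of a polynomial: move one
point along a line while the other ones stay put on a second line. -/
theorem prod_sqDistPoly_ne_sq {V : Type*} [Finite V] {d : ℕ} (hd : 2 ≤ d) {ι : Type*}
    (S : Finset ι) (hS : S.Nonempty) (u w : ι → V) (hne : ∀ i ∈ S, u i ≠ w i)
    (hinj : Set.InjOn (fun i => s(u i, w i)) S) (c : MvPolynomial (V × Fin d) ℤ) :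
    ∏ i ∈ S, sqDistPoly d (u i) (w i) ≠ c ^ 2 := by
  classical
  intro h
  have := Fintype.ofFinite V
  obtain ⟨i₀, hi₀⟩ := hS
  -- Only two properties matter: the values are nonzero and their squares are distinct.
  let f : V → ℂ := fun v => ((Fintype.equivFin V v : ℕ) : ℂ) + 1
  have hf : ∀ v v', f v ^ 2 = f v' ^ 2 → v = v' := by
    intro v v' hvv
    have h1 : ((Fintype.equivFin V v : ℕ) + 1) ^ 2 = ((Fintype.equivFin V v' : ℕ) + 1) ^ 2 := by
      simp only [f] at hvv
      exact_mod_cast hvv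
    have h2 := Nat.pow_left_injective (n := 2) (by norm_num) h1
    exact (Fintype.equivFin V).injective (Fin.ext (by simpa using h2))
  have hf0 : ∀ v, f v ≠ 0 := fun v => Nat.cast_add_one_ne_zero _
  let j₀ : Fin d := ⟨0, by lia⟩
  let j₁ : Fin d := ⟨1, by lia⟩
  have hj : j₁ ≠ j₀ := by simp [j₀, j₁]
  -- The vertex `u i₀` goes to $(X,0)$ and every other $v$ to $(0,f(v))$, so squared distances
  -- become $X^2+f(v)^2$ or nonzero constants.
  let A : V → Polynomial ℂ := fun v => if v = u i₀ then Polynomial.X else 0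
  let B : V → Polynomial ℂ := fun v => if v = u i₀ then 0 else Polynomial.C (f v)
  let φ := MvPolynomial.aeval (R := ℤ) (fun k : V × Fin d =>
    if k.2 = j₀ then A k.1 else if k.2 = j₁ then B k.1 else 0)
  have hφ : ∀ v v', φ (sqDistPoly d v v') = (A v - A v') ^ 2 + (B v - B v') ^ 2 := by
    intro v v'
    simp only [φ, sqDistPoly, map_sum, map_pow, map_sub, MvPolynomial.aeval_X]
    have : ∀ j : Fin d, ((if j = j₀ then A v else if j = j₁ then B v else 0) -
        (if j = j₀ then A v' else if j = j₁ then B v' else 0)) ^ 2 =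
        (if j = j₀ then (A v - A v') ^ 2 else 0) + (if j = j₁ then (B v - B v') ^ 2 else 0) := by
      intro j
      by_cases h0 : j = j₀
      · subst h0
        simp [hj.symm]
      · by_cases h1 : j = j₁ <;> simp [h0, h1, hj]
    simp [this, Finset.sum_add_distrib]
  have hcomm : ∀ v v', φ (sqDistPoly d v v') = φ (sqDistPoly d v' v) := fun v v' => by
    rw [hφ, hφ]; ring
  have hu : ∀ v, v ≠ u i₀ →
      φ (sqDistPoly d (u i₀) v) = Polynomial.X ^ 2 + Polynomial.C (f v ^ 2) := by
    intro v hv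
    rw [hφ]
    simp [A, B, hv]
  -- A root of the factor of `i₀` and of no other factor. It is simple since $z\neq -z$, whereas a
  -- square has no simple root.
  let z : ℂ := Complex.I * f (w i₀)
  have hz : z ^ 2 = - f (w i₀) ^ 2 := by
    simp only [z]
    rw [mul_pow, Complex.I_sq]; ring
  have hz0 : z ≠ 0 := mul_ne_zero Complex.I_ne_zero (hf0 _)
  have hmain : ∀ i ∈ S.erase i₀, (φ (sqDistPoly d (u i) (w i))).eval z ≠ 0 := by
    intro i hi h0
    obtain ⟨hii, hiS⟩ := Finset.mem_erase.1 hi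
    have hs : s(u i, w i) ≠ s(u i₀, w i₀) := fun hh => hii (hinj hiS hi₀ hh)
    have hfar : ∀ v, v ≠ u i₀ → (φ (sqDistPoly d (u i₀) v)).eval z = 0 → v = w i₀ := by
      intro v hv h
      rw [hu v hv] at h
      simp only [Polynomial.eval_add, Polynomial.eval_pow, Polynomial.eval_X,
        Polynomial.eval_C] at h
      exact hf _ _ (by linear_combination h - hz)
    by_cases h1 : u i = u i₀
    · rw [h1] at h0
      have := hfar _ (fun hh => hne i hiS (h1.trans hh.symm)) h0
      exact hs (by rw [h1, this])
    · by_cases h2 : w i = u i₀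
      · rw [h2, hcomm] at h0
        have := hfar _ h1 h0
        exact hs (by rw [h2, this, Sym2.eq_swap])
      · rw [hφ] at h0
        simp only [A, B, h1, h2, if_false] at h0
        simp only [sub_zero, Polynomial.eval_add, Polynomial.eval_pow, Polynomial.eval_sub,
          Polynomial.eval_C, Polynomial.eval_zero] at h0
        have h3 : f (u i) = f (w i) := by
          have : (f (u i) - f (w i)) ^ 2 = 0 := by linear_combination h0
          exact sub_eq_zero.1 (pow_eq_zero_iff (two_ne_zero) |>.1 this)
        exact hne i hiS (hf _ _ (by rw [h3]))
  have hprod := congrArg φ h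
  rw [← Finset.mul_prod_erase S _ hi₀, map_mul, map_pow, map_prod,
    hu _ (hne i₀ hi₀).symm] at hprod
  set P := ∏ i ∈ S.erase i₀, φ (sqDistPoly d (u i) (w i)) with hP
  have hPz : P.eval z ≠ 0 := by
    rw [hP, Polynomial.eval_prod]
    exact Finset.prod_ne_zero_iff.2 hmain
  have hfac : (Polynomial.X ^ 2 + Polynomial.C (f (w i₀) ^ 2) : Polynomial ℂ) =
      (Polynomial.X - Polynomial.C z) * (Polynomial.X + Polynomial.C z) := by
    have : f (w i₀) ^ 2 = - z ^ 2 := by rw [hz]; ring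
    rw [this]
    simp only [map_neg, map_pow]
    ring
  rw [hfac] at hprod
  have hroot : (φ c).eval z = 0 := by
    have := congrArg (Polynomial.eval z) hprod
    simp only [Polynomial.eval_mul, Polynomial.eval_sub, Polynomial.eval_X, Polynomial.eval_C,
      sub_self, zero_mul, Polynomial.eval_pow] at this
    exact pow_eq_zero_iff (two_ne_zero) |>.1 this.symm
  obtain ⟨g, hg⟩ := Polynomial.dvd_iff_isRoot.2 hroot
  rw [hg] at hprod
  have hcancel : (Polynomial.X + Polynomial.C z) * P = (Polynomial.X - Polynomial.C z) * g ^ 2 :=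
    mul_left_cancel₀ (Polynomial.X_sub_C_ne_zero z) (by linear_combination hprod)
  have := congrArg (Polynomial.eval z) hcancel
  simp only [Polynomial.eval_mul, Polynomial.eval_add, Polynomial.eval_sub, Polynomial.eval_X,
    Polynomial.eval_C, sub_self, zero_mul] at this
  rcases mul_eq_zero.1 this with h | h
  · exact hz0 (by linear_combination h / 2)
  · exact hPz h

/-- For a generic configuration, the products of distinct distances are linearly independent over
the ring generated by the coordinates. -/
theorem IsGeneric.sum_mul_prod_dist_eq_zero {V : Type*} [Finite V] {d : ℕ} (hd : 2 ≤ d)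
    {x : V → EuclideanSpace ℝ (Fin d)} (hx : IsGeneric x) {ι : Type*} [DecidableEq ι]
    (D : Finset ι) (u w : ι → V) (hne : ∀ i ∈ D, u i ≠ w i)
    (hinj : Set.InjOn (fun i => s(u i, w i)) D) (c : Finset ι → ℝ) (hc : ∀ S, c S ∈ coordRing x)
    (hsum : ∑ S ∈ D.powerset, c S * ∏ i ∈ S, ‖x (u i) - x (w i)‖ = 0) :
    ∀ S ⊆ D, c S = 0 := by
  refine sum_mul_prod_sqrt_eq_zero _ D (coordRing x)
    (fun i _ => mem_coordRing.2 ⟨_, aeval_sqDistPoly x _ _⟩) ?_ c hc hsum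
  rintro S hS hSne _ ⟨a, rfl⟩ _ ⟨b, rfl⟩ h
  change _ * (MvPolynomial.aeval _ b) ^ 2 = (MvPolynomial.aeval _ a) ^ 2 at h
  change MvPolynomial.aeval _ b = (0 : ℝ)
  have hpoly : (∏ i ∈ S, sqDistPoly d (u i) (w i)) * b ^ 2 = a ^ 2 := by
    rw [← sub_eq_zero]
    refine hx _ ?_
    rw [map_sub, map_mul, map_prod, map_pow, map_pow, sub_eq_zero]
    simpa only [aeval_sqDistPoly] using h
  by_cases hb : b = 0
  · rw [hb, map_zero]
  · exfalso
    -- Unique factorization: $b^2\mid a^2$ gives $b\mid a$, so the product would be the square of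
    -- the polynomial $e=a/b$.
    obtain ⟨e, rfl⟩ := (UniqueFactorizationMonoid.pow_dvd_pow_iff_dvd two_ne_zero).1
      (Dvd.intro_left _ hpoly)
    exact prod_sqDistPoly_ne_sq hd S hSne u w (fun i hi => hne i (hS hi)) (hinj.mono hS) e
      (mul_right_cancel₀ (pow_ne_zero 2 hb) (by rw [hpoly]; ring))

/-! ### Minors and the union of linear matroids -/

/-- Finitely many vectors are linearly independent iff some maximal minor does not vanish. -/
theorem linearIndependent_iff_exists_det_ne_zero {K ι κ : Type*} [Field K] [Fintype ι]
    [DecidableEq ι] [Finite κ] (v : ι → κ → K) :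
    LinearIndependent K v ↔ ∃ f : ι → κ, (Matrix.of fun i j => v i (f j)).det ≠ 0 := by
  have := Fintype.ofFinite κ
  constructor
  · intro h
    have hrank : (Matrix.of v).rank = Fintype.card ι := LinearIndependent.rank_matrix h
    obtain ⟨κ', a, -, hspan, hli⟩ :=
      exists_linearIndependent' K (fun k i => v i k : κ → ι → K)
    have := hli.finite
    have := Fintype.ofFinite κ'
    have hcard : Fintype.card ι = Fintype.card κ' := by
      rw [← hrank, Matrix.rank_eq_finrank_span_cols,
        linearIndependent_iff_card_eq_finrank_span.1 hli]
      unfold Set.finrank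
      rw [hspan]
      rfl
    let e := Fintype.equivOfCardEq hcard
    refine ⟨a ∘ e, ?_⟩
    have hli' := hli.comp e e.injective
    have := Matrix.linearIndependent_cols_iff_isUnit
      (A := Matrix.of fun i j => v i (a (e j))) |>.1 hli'
    exact ((Matrix.isUnit_iff_isUnit_det _).1 this).ne_zero
  · rintro ⟨f, hf⟩
    have := Matrix.linearIndependent_rows_of_det_ne_zero hf
    exact LinearIndependent.of_comp (LinearMap.funLeft K K f) this

/-- Multilinear expansion of the determinant along the rows that are written as sums. -/
theorem det_ite_add_smul {R ι : Type*} [CommRing R] [Fintype ι] [DecidableEq ι] (D : Finset ι)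
    (t : ι → R) (a b : ι → ι → R) :
    (Matrix.of fun i => if i ∈ D then a i + t i • b i else a i).det =
      ∑ S ∈ D.powerset, (Matrix.of (S.piecewise b a)).det * ∏ i ∈ S, t i := by
  have h := (Matrix.detRowAlternating (R := R) (n := ι)).toMultilinearMap.map_piecewise_add
    (fun i => t i • b i) a D
  have h1 : D.piecewise ((fun i => t i • b i) + a) a =
      fun i => if i ∈ D then a i + t i • b i else a i := by
    funext i
    by_cases hi : i ∈ D <;> simp [hi, add_comm]
  rw [h1] at h
  refine Eq.trans h (Finset.sum_congr rfl fun S _ => ?_)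
  have h2 := (Matrix.detRowAlternating (R := R) (n := ι)).toMultilinearMap.map_piecewise_smul
    t (S.piecewise b a) S
  have h3 : S.piecewise (fun i => t i • S.piecewise b a i) (S.piecewise b a) =
      S.piecewise (fun i => t i • b i) a := by
    funext i
    by_cases hi : i ∈ S <;> simp [hi]
  rw [h3] at h2
  rw [h2, smul_eq_mul, mul_comm]
  rfl

/-- The easy half of the matroid union theorem for linear matroids. -/
theorem LinearIndependent.exists_piecewise_of_add_smul {K ι κ : Type*} [Field K] [Finite ι]
    [DecidableEq ι] [Finite κ] {t : ι → K} {a b : ι → κ → K}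
    (h : LinearIndependent K fun i => a i + t i • b i) :
    ∃ S : Finset ι, LinearIndependent K (S.piecewise b a) := by
  have := Fintype.ofFinite ι
  obtain ⟨f, hf⟩ := (linearIndependent_iff_exists_det_ne_zero _).1 h
  have hexp := det_ite_add_smul Finset.univ t (fun i j => a i (f j)) (fun i j => b i (f j))
  have h1 : (Matrix.of fun i : ι => if i ∈ Finset.univ then
      (fun j => a i (f j)) + t i • (fun j => b i (f j)) else fun j => a i (f j)) =
      Matrix.of fun i j => (a i + t i • b i) (f j) := by
    ext i j
    simp
  rw [h1] at hexp
  rw [hexp] at hf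
  obtain ⟨S, -, hS⟩ := Finset.exists_ne_zero_of_sum_ne_zero hf
  refine ⟨S, (linearIndependent_iff_exists_det_ne_zero _).2 ⟨f, ?_⟩⟩
  convert left_ne_zero_of_mul hS using 3
  ext i j
  by_cases hi : i ∈ S <;> simp [hi]

theorem Matrix.det_mem_subring {K ι : Type*} [CommRing K] [Fintype ι] [DecidableEq ι]
    (R : Subring K) (M : Matrix ι ι K) (hM : ∀ i j, M i j ∈ R) : M.det ∈ R := by
  rw [Matrix.det_apply']
  exact R.sum_mem fun σ _ => R.mul_mem (intCast_mem R _) (R.prod_mem fun i _ => hM _ _)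

/-- The hard half of the matroid union theorem for linear matroids, with weights `t i` whose
square-free monomials are linearly independent over a subring containing all entries. -/
theorem LinearIndependent.ite_add_smul_of_piecewise {K ι κ : Type*} [Field K] [Finite ι]
    [DecidableEq ι] [Finite κ] (R : Subring K) (D : Finset ι) (t : ι → K)
    (ht : ∀ c : Finset ι → K, (∀ S, c S ∈ R) →
      ∑ S ∈ D.powerset, c S * ∏ i ∈ S, t i = 0 → ∀ S ⊆ D, c S = 0)
    {a b : ι → κ → K} (ha : ∀ i k, a i k ∈ R) (hb : ∀ i k, b i k ∈ R) {S : Finset ι}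
    (hS : S ⊆ D) (h : LinearIndependent K (S.piecewise b a)) :
    LinearIndependent K fun i => if i ∈ D then a i + t i • b i else a i := by
  have := Fintype.ofFinite ι
  obtain ⟨f, hf⟩ := (linearIndependent_iff_exists_det_ne_zero _).1 h
  refine (linearIndependent_iff_exists_det_ne_zero _).2 ⟨f, fun h0 => hf ?_⟩
  have hexp := det_ite_add_smul D t (fun i j => a i (f j)) (fun i j => b i (f j))
  have h1 : (Matrix.of fun i : ι => if i ∈ D then
      (fun j => a i (f j)) + t i • (fun j => b i (f j)) else fun j => a i (f j)) =
      Matrix.of fun i j => (if i ∈ D then a i + t i • b i else a i) (f j) := by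
    ext i j
    by_cases hi : i ∈ D <;> simp [hi]
  rw [h1, h0] at hexp
  -- Every coefficient of the expansion lies in $R$. A vanishing determinant would kill them all,
  -- including the nonzero minor indexed by `S`.
  have h2 := ht
    (fun S => (Matrix.of (S.piecewise (fun i j => b i (f j)) (fun i j => a i (f j)))).det)
    (fun S => Matrix.det_mem_subring R _ fun i j => by by_cases hi : i ∈ S <;> simp [hi, ha, hb])
    hexp.symm S hS
  refine Eq.trans ?_ h2
  congr 1
  ext i j
  by_cases hi : i ∈ S <;> simp [hi]

/-! ### Incidence matrices and connectedness -/

section Incidence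

variable {V : Type*} [DecidableEq V]

/-- The row of an arc in the signed incidence matrix of a digraph. -/
def incidenceRow (a : V × V) : V → ℝ :=
  Pi.single a.2 1 - Pi.single a.1 1

theorem incidenceRow_swap (a : V × V) : incidenceRow a.swap = -incidenceRow a := by
  simp [incidenceRow]

theorem biasRow_eq_smul {d : ℕ} (x : V → EuclideanSpace ℝ (Fin d)) (a : V × V) :
    biasRow x a.1 a.2 = ‖x a.1 - x a.2‖ • incidenceRow a := by
  funext c
  by_cases h : a.1 = a.2
  · simp [biasRow, h]
  · by_cases h1 : c = a.1
    · have : c ≠ a.2 := fun h2 => h (h1.symm.trans h2)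
      simp [biasRow, incidenceRow, h1, h]
    · by_cases h2 : c = a.2
      · simp [biasRow, incidenceRow, h2, Ne.symm h]
      · simp [biasRow, incidenceRow, h1, h2]

variable [Fintype V]

theorem incidenceMatrix_mulVec {ι : Type*} (a : ι → V × V) (α : V → ℝ) (i : ι) :
    (Matrix.of fun i => incidenceRow (a i)).mulVec α i = α (a i).2 - α (a i).1 := by
  change incidenceRow (a i) ⬝ᵥ α = _
  rw [incidenceRow, sub_dotProduct, single_one_dotProduct, single_one_dotProduct]

theorem incidenceMatrix_rank_add {ι : Type*} [Finite ι] (a : ι → V × V) :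
    (Module.finrank ℝ (Submodule.span ℝ (Set.range fun i => incidenceRow (a i)))) +
      Module.finrank ℝ (LinearMap.ker (Matrix.of fun i => incidenceRow (a i)).mulVecLin) =
      Fintype.card V := by
  have h1 := Matrix.rank_eq_finrank_span_row (Matrix.of fun i => incidenceRow (a i))
  have h2 := (Matrix.of fun i => incidenceRow (a i)).mulVecLin.finrank_range_add_finrank_ker
  rw [Module.finrank_fintype_fun_eq_card] at h2
  rw [← h2]
  congr 1
  exact h1.symm

/-- The kernel consists of the functions constant on connected components; every rank estimate below
is read off from it. -/
theorem mem_ker_incidenceMatrix {ι : Type*} {a : ι → V × V} {α : V → ℝ} :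
    α ∈ LinearMap.ker (Matrix.of fun i => incidenceRow (a i)).mulVecLin ↔
      ∀ i, α (a i).1 = α (a i).2 := by
  rw [LinearMap.mem_ker, Matrix.mulVecLin_apply, funext_iff]
  simp only [incidenceMatrix_mulVec, Pi.zero_apply, sub_eq_zero]
  exact forall_congr' fun i => eq_comm

theorem finrank_span_incidenceRow_le [Nonempty V] {ι : Type*} [Finite ι] (a : ι → V × V) :
    Module.finrank ℝ (Submodule.span ℝ (Set.range fun i => incidenceRow (a i))) ≤
      Fintype.card V - 1 := by
  have h := incidenceMatrix_rank_add a
  have : 1 ≤ Module.finrank ℝ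
      (LinearMap.ker (Matrix.of fun i => incidenceRow (a i)).mulVecLin) := by
    rw [← finrank_span_singleton (K := ℝ) (v := (1 : V → ℝ)) one_ne_zero]
    refine Submodule.finrank_mono ?_
    rw [Submodule.span_singleton_le_iff_mem, mem_ker_incidenceMatrix]
    simp
  lia

/-- Along paths of $H$ a kernel vector is constant, so the kernel is at most a line. The family may
contain further arcs, and the orientations are irrelevant. -/
theorem card_sub_one_le_finrank_span_incidenceRow {ι : Type*} [Finite ι] (a : ι → V × V)
    {H : SimpleGraph V} (hH : H.Connected)
    (ha : ∀ u w, H.Adj u w → ∃ i, a i = (u, w) ∨ a i = (w, u)) :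
    Fintype.card V - 1 ≤
      Module.finrank ℝ (Submodule.span ℝ (Set.range fun i => incidenceRow (a i))) := by
  have h := incidenceMatrix_rank_add a
  have : Module.finrank ℝ
      (LinearMap.ker (Matrix.of fun i => incidenceRow (a i)).mulVecLin) ≤ 1 := by
    have hle : LinearMap.ker (Matrix.of fun i => incidenceRow (a i)).mulVecLin ≤
        Submodule.span ℝ {(1 : V → ℝ)} := by
      intro α hα
      rw [mem_ker_incidenceMatrix] at hα
      have hadj : ∀ u w, H.Adj u w → α u = α w := by
        intro u w huw
        obtain ⟨i, hi | hi⟩ := ha u w huw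
        · simpa [hi] using hα i
        · simpa [hi] using (hα i).symm
      have hreach : ∀ u w, H.Reachable u w → α u = α w := by
        rintro u w ⟨q⟩
        induction q with
        | nil => rfl
        | cons h _ ih => exact (hadj _ _ h).trans ih
      obtain ⟨v₀⟩ := hH.nonempty
      refine Submodule.mem_span_singleton.2 ⟨α v₀, ?_⟩
      funext v
      simpa using hreach v₀ v (hH.preconnected v₀ v)
    refine (Submodule.finrank_mono hle).trans ?_
    exact finrank_span_singleton (K := ℝ) (v := (1 : V → ℝ))
      (by obtain ⟨v⟩ := hH.nonempty; exact fun h => one_ne_zero (congrFun h v)) |>.le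
  lia

theorem connected_of_card_sub_one_le_finrank [Nonempty V] {ι : Type*} [Finite ι] (a : ι → V × V)
    {H : SimpleGraph V} (ha : ∀ i, H.Adj (a i).1 (a i).2)
    (h : Fintype.card V - 1 ≤
      Module.finrank ℝ (Submodule.span ℝ (Set.range fun i => incidenceRow (a i)))) :
    H.Connected := by
  classical
  have hadd := incidenceMatrix_rank_add a
  have hpos : 0 < Fintype.card V := Fintype.card_pos
  have hker : LinearMap.ker (Matrix.of fun i => incidenceRow (a i)).mulVecLin =
      Submodule.span ℝ {(1 : V → ℝ)} := by
    refine (Submodule.eq_of_le_of_finrank_le ?_ ?_).symm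
    · rw [Submodule.span_singleton_le_iff_mem, mem_ker_incidenceMatrix]
      simp
    · rw [finrank_span_singleton one_ne_zero]
      lia
  refine ⟨fun u w => ?_⟩
  -- The indicator of the component of `u` is in the kernel, hence constant, so the component is
  -- everything.
  have hmem : (fun v => if H.Reachable u v then (1 : ℝ) else 0) ∈
      LinearMap.ker (Matrix.of fun i => incidenceRow (a i)).mulVecLin := by
    rw [mem_ker_incidenceMatrix]
    intro i
    have : H.Reachable u (a i).1 ↔ H.Reachable u (a i).2 :=
      ⟨fun h => h.trans (ha i).reachable, fun h => h.trans (ha i).symm.reachable⟩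
    simp only [this]
  rw [hker] at hmem
  obtain ⟨r, hr⟩ := Submodule.mem_span_singleton.1 hmem
  have hru := congrFun hr u
  have hrw := congrFun hr w
  by_contra hn
  simp [hn] at hru hrw
  exact one_ne_zero (hru.symm.trans hrw)

end Incidence

/-! ### The Euclidean rigidity matrix and its maximal rank -/

section Euclidean

variable {V : Type*} [DecidableEq V] {d : ℕ}

/-- The entries of the rows of the Euclidean rigidity matrix as polynomials. -/
noncomputable def euclideanRowPoly (d : ℕ) (a : V × V) (c : V × Fin d) :
    MvPolynomial (V × Fin d) ℤ :=
  if c.1 = a.1 then MvPolynomial.X (a.1, c.2) - MvPolynomial.X (a.2, c.2)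
  else if c.1 = a.2 then MvPolynomial.X (a.2, c.2) - MvPolynomial.X (a.1, c.2) else 0

theorem aeval_euclideanRowPoly (x : V → EuclideanSpace ℝ (Fin d)) (a : V × V) (c : V × Fin d) :
    MvPolynomial.aeval (fun c => x c.1 c.2) (euclideanRowPoly d a c) =
      euclideanRow x a.1 a.2 c := by
  unfold euclideanRowPoly euclideanRow
  split_ifs <;> simp

variable [Fintype V]

/-- Independence of Euclidean rows is the same at all generic configurations. -/
theorem LinearIndependent.euclideanRow_of_isGeneric {ι : Type*} [Finite ι] {a : ι → V × V}
    {x x' : V → EuclideanSpace ℝ (Fin d)} (hx' : IsGeneric x')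
    (h : LinearIndependent ℝ fun i => euclideanRow x (a i).1 (a i).2) :
    LinearIndependent ℝ fun i => euclideanRow x' (a i).1 (a i).2 := by
  classical
  have := Fintype.ofFinite ι
  obtain ⟨f, hf⟩ := (linearIndependent_iff_exists_det_ne_zero _).1 h
  -- The minor is an integer polynomial in the coordinates: if it vanishes at the generic `x'`, it
  -- is zero and vanishes at `x` too. No genericity of `x` is needed.
  refine (linearIndependent_iff_exists_det_ne_zero _).2 ⟨f, fun h0 => hf ?_⟩
  have key : ∀ y : V → EuclideanSpace ℝ (Fin d),
      (Matrix.of fun i j => euclideanRow y (a i).1 (a i).2 (f j)).det =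
      MvPolynomial.aeval (fun c => y c.1 c.2)
        (Matrix.of fun i j => euclideanRowPoly d (a i) (f j)).det := by
    intro y
    rw [AlgHom.map_det]
    congr 1
    ext i j
    simp [aeval_euclideanRowPoly]
  rw [key] at h0 ⊢
  rw [hx' _ h0, map_zero]

theorem sum_euclideanRow_mul (x : V → EuclideanSpace ℝ (Fin d)) (u w : V) (v : V × Fin d → ℝ) :
    ∑ c, euclideanRow x u w c * v c = ∑ i, (x u i - x w i) * (v (u, i) - v (w, i)) := by
  rw [Fintype.sum_prod_type_right]
  refine Finset.sum_congr rfl fun i _ => ?_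
  by_cases h : u = w
  · subst h
    simp [euclideanRow]
  · have : ∀ z, euclideanRow x u w (z, i) * v (z, i) =
        (if z = u then (x u i - x w i) * v (u, i) else 0) +
        (if z = w then (x w i - x u i) * v (w, i) else 0) := by
      intro z
      by_cases h1 : z = u
      · subst h1; simp [euclideanRow, h]
      · by_cases h2 : z = w
        · subst h2; simp [euclideanRow, h1]
        · simp [euclideanRow, h1, h2]
    simp only [this, Finset.sum_add_distrib, Finset.sum_ite_eq', Finset.mem_univ, if_true]
    ring

/-- The skew-symmetric matrix with prescribed entries above the diagonal. -/
def skewOfUpper (s : {q : Fin d × Fin d // q.1 < q.2} → ℝ) (i j : Fin d) : ℝ :=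
  if h : i < j then s ⟨(i, j), h⟩ else if h : j < i then -s ⟨(j, i), h⟩ else 0

theorem skewOfUpper_comm (s : {q : Fin d × Fin d // q.1 < q.2} → ℝ) (i j : Fin d) :
    skewOfUpper s i j = -skewOfUpper s j i := by
  unfold skewOfUpper
  rcases lt_trichotomy i j with h | h | h
  · simp [h, h.not_gt]
  · simp [h]
  · simp [h, h.not_gt]

theorem skewOfUpper_add (s s' : {q : Fin d × Fin d // q.1 < q.2} → ℝ) (i j : Fin d) :
    skewOfUpper (s + s') i j = skewOfUpper s i j + skewOfUpper s' i j := by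
  unfold skewOfUpper
  split_ifs <;> simp [add_comm]

theorem skewOfUpper_smul (r : ℝ) (s : {q : Fin d × Fin d // q.1 < q.2} → ℝ) (i j : Fin d) :
    skewOfUpper (r • s) i j = r * skewOfUpper s i j := by
  unfold skewOfUpper
  split_ifs <;> simp

/-- The infinitesimal Euclidean motions of a configuration. -/
def euclideanMotion (x : V → EuclideanSpace ℝ (Fin d)) :
    (({q : Fin d × Fin d // q.1 < q.2} → ℝ) × (Fin d → ℝ)) →ₗ[ℝ] (V × Fin d → ℝ) where
  toFun s c := ∑ j, skewOfUpper s.1 c.2 j * x c.1 j + s.2 c.2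
  map_add' s s' := by
    funext c
    simp only [Prod.fst_add, Prod.snd_add, Pi.add_apply, skewOfUpper_add, add_mul,
      Finset.sum_add_distrib]
    ring
  map_smul' r s := by
    funext c
    simp only [Prod.smul_fst, Prod.smul_snd, Pi.smul_apply, smul_eq_mul, skewOfUpper_smul,
      RingHom.id_apply, mul_add, Finset.mul_sum, mul_assoc]

/-- Translations cancel in the difference, and the quadratic form of a skew-symmetric matrix
vanishes. -/
theorem sum_euclideanRow_mul_euclideanMotion (x : V → EuclideanSpace ℝ (Fin d)) (u w : V)
    (s : ({q : Fin d × Fin d // q.1 < q.2} → ℝ) × (Fin d → ℝ)) :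
    ∑ c, euclideanRow x u w c * euclideanMotion x s c = 0 := by
  rw [sum_euclideanRow_mul]
  have h1 : ∀ i, (x u i - x w i) * (euclideanMotion x s (u, i) - euclideanMotion x s (w, i)) =
      ∑ j, (x u i - x w i) * skewOfUpper s.1 i j * (x u j - x w j) := by
    intro i
    simp only [euclideanMotion, LinearMap.coe_mk, AddHom.coe_mk, add_sub_add_right_eq_sub,
      ← Finset.sum_sub_distrib, Finset.mul_sum]
    exact Finset.sum_congr rfl fun j _ => by ring
  simp only [h1]
  have h2 : ∑ i, ∑ j, (x u i - x w i) * skewOfUpper s.1 i j * (x u j - x w j) =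
      -∑ i, ∑ j, (x u i - x w i) * skewOfUpper s.1 i j * (x u j - x w j) := by
    conv_lhs => rw [Finset.sum_comm]
    simp only [← Finset.sum_neg_distrib]
    refine Finset.sum_congr rfl fun i _ => Finset.sum_congr rfl fun j _ => ?_
    rw [skewOfUpper_comm s.1 j i]
    ring
  linarith

/-- A generic configuration of more than `d` points spans `ℝ ^ d`. -/
theorem euclideanMotion_injective (hn : d + 1 ≤ Fintype.card V)
    {x : V → EuclideanSpace ℝ (Fin d)} (hx : IsGeneric x) :
    Function.Injective (euclideanMotion x) := by
  obtain ⟨f⟩ : Nonempty (Option (Fin d) ↪ V) :=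
    Function.Embedding.nonempty_of_card_le (by simpa using hn)
  let N : Matrix (Fin d) (Fin d) (MvPolynomial (V × Fin d) ℤ) :=
    Matrix.of fun j k => MvPolynomial.X (f (some k), j) - MvPolynomial.X (f none, j)
  have hN : N.det ≠ 0 := by
    intro h
    -- Place the base point `f none` at the origin and the other chosen points at the standard basis
    -- vectors: the matrix becomes the identity.
    have h1 := congrArg (MvPolynomial.aeval (R := ℤ)
      fun c : V × Fin d => if c.1 = f (some c.2) then (1 : ℤ) else 0) h
    rw [AlgHom.map_det, map_zero] at h1
    have h2 : (MvPolynomial.aeval (R := ℤ) fun c : V × Fin d =>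
        if c.1 = f (some c.2) then (1 : ℤ) else 0).mapMatrix N = 1 := by
      ext j k
      simp [N, Matrix.one_apply, eq_comm]
    rw [h2, Matrix.det_one] at h1
    exact one_ne_zero h1
  have hdet : (Matrix.of fun j k => x (f (some k)) j - x (f none) j).det ≠ 0 := by
    intro h
    refine hN (hx _ ?_)
    rw [AlgHom.map_det, ← h]
    congr 1
    ext j k
    simp [N]
  rw [injective_iff_map_eq_zero]
  rintro ⟨s, c⟩ hs
  have hs' : ∀ v i, ∑ j, skewOfUpper s i j * x v j + c i = 0 := fun v i => congrFun hs (v, i)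
  have hskew : ∀ i j, skewOfUpper s i j = 0 := by
    intro i
    -- Subtracting the equation at the base point removes the translation, so each row of the skew
    -- matrix annihilates $d$ independent differences.
    have h0 : Matrix.vecMul (skewOfUpper s i)
        (Matrix.of fun j k => x (f (some k)) j - x (f none) j) = 0 := by
      funext k
      have h1 := hs' (f (some k)) i
      have h2 := hs' (f none) i
      simp only [Matrix.vecMul, dotProduct, Matrix.of_apply, mul_sub, Finset.sum_sub_distrib,
        Pi.zero_apply]
      linarith
    exact congrFun (Matrix.eq_zero_of_vecMul_eq_zero hdet h0)
  refine Prod.ext ?_ ?_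
  · funext q
    have := hskew q.1.1 q.1.2
    simpa [skewOfUpper, q.2] using this
  · funext i
    simpa [hskew] using hs' (f none) i

theorem card_lt_pairs (d : ℕ) :
    Fintype.card {q : Fin d × Fin d // q.1 < q.2} = d.choose 2 := by
  rw [Fintype.card_subtype, Fintype.card_product_filter_lt, Fintype.card_fin]

/-- The rank of Euclidean rigidity matrices at generic configurations is at most
`maxEuclideanRank`. -/
theorem finrank_span_euclideanRow_le {x : V → EuclideanSpace ℝ (Fin d)} (hx : IsGeneric x)
    {ι : Type*} (a : ι → V × V) :
    Module.finrank ℝ (Submodule.span ℝ (Set.range fun i => euclideanRow x (a i).1 (a i).2)) ≤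
      maxEuclideanRank (Fintype.card V) d := by
  unfold maxEuclideanRank
  split_ifs with hn
  · have hle : Submodule.span ℝ (Set.range fun i => euclideanRow x (a i).1 (a i).2) ≤
        Submodule.span ℝ (Set.range (Matrix.of fun b : V × V => euclideanRow x b.1 b.2).row) :=
      Submodule.span_mono (by rintro _ ⟨i, rfl⟩; exact ⟨a i, rfl⟩)
    refine (Submodule.finrank_mono hle).trans ?_
    rw [← Matrix.rank_eq_finrank_span_row]
    have hadd := (Matrix.of fun b : V × V =>
      euclideanRow x b.1 b.2).mulVecLin.finrank_range_add_finrank_ker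
    -- The motions form a subspace of the kernel of dimension $\binom d2+d=\binom{d+1}2$.
    have hker : LinearMap.range (euclideanMotion x) ≤
        LinearMap.ker (Matrix.of fun b : V × V => euclideanRow x b.1 b.2).mulVecLin := by
      rintro _ ⟨s, rfl⟩
      rw [LinearMap.mem_ker]
      funext b
      exact sum_euclideanRow_mul_euclideanMotion x b.1 b.2 s
    have hrange := Submodule.finrank_mono hker
    rw [LinearMap.finrank_range_of_inj (euclideanMotion_injective hn hx), Module.finrank_prod,
      Module.finrank_fintype_fun_eq_card, Module.finrank_fintype_fun_eq_card, card_lt_pairs,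
      Fintype.card_fin] at hrange
    rw [Module.finrank_fintype_fun_eq_card, Fintype.card_prod, Fintype.card_fin] at hadd
    have hchoose : (d + 1).choose 2 = d + d.choose 2 := by
      rw [Nat.choose_succ_succ' d 1, Nat.choose_one_right]
    rw [mul_comm d]
    change Module.finrank ℝ (LinearMap.range _) ≤ _
    lia
  -- With at most $d$ points, the number of edges of the complete graph bounds the rank.
  · have hle : Submodule.span ℝ (Set.range fun i => euclideanRow x (a i).1 (a i).2) ≤
        Submodule.span ℝ (Set.range (euclideanRigidityMatrix (⊤ : SimpleGraph V) x).row) := by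
      rw [Submodule.span_le]
      rintro _ ⟨i, rfl⟩
      by_cases h : (a i).1 = (a i).2
      · have h0 : euclideanRow x (a i).1 (a i).2 = 0 := by
          funext c
          simp [euclideanRow, h]
        simp only [h0]
        exact Submodule.zero_mem _
      · exact Submodule.subset_span ⟨⟨s((a i).1, (a i).2), h⟩, rfl⟩
    refine (Submodule.finrank_mono hle).trans ?_
    rw [← Matrix.rank_eq_finrank_span_row]
    refine (Matrix.rank_le_card_height _).trans ?_
    rw [← Set.toFinset_card, ← SimpleGraph.edgeFinset, SimpleGraph.card_edgeFinset_top_eq_card_choose_two]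

end Euclidean

/-! ### Orientations and edge counts of conic graphs -/

section Graphs

variable {V : Type*}

theorem SimpleGraph.ncard_adj_eq_twice_ncard_edgeSet [Finite V] (G : SimpleGraph V) :
    {a : V × V | G.Adj a.1 a.2}.ncard = 2 * G.edgeSet.ncard := by
  classical
  have := Fintype.ofFinite V
  rw [← SimpleGraph.coe_edgeFinset, Set.ncard_coe_finset, ← G.dart_card_eq_twice_card_edges,
    ← Nat.card_eq_fintype_card, ← Nat.card_coe_set_eq]
  exact Nat.card_congr
    { toFun := fun a => ⟨a.1, a.2⟩
      invFun := fun a => ⟨a.toProd, a.adj⟩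
      left_inv := fun _ => rfl
      right_inv := fun _ => rfl }

/-- A digraph has as many arcs as its conic graph has edges. -/
theorem SimpleDigraph.ncard_arcSet [Finite V] (Γ : SimpleDigraph V) :
    Γ.arcSet.ncard = Γ.conicGraph.numEdges := by
  have h1 : {a : V × V | Γ.Adj a.1 a.2 ∧ ¬Γ.Adj a.2 a.1}.ncard =
      Γ.conicGraph.simple.edgeSet.ncard := by
    have himg : Γ.conicGraph.simple.edgeSet =
        (fun a : V × V => s(a.1, a.2)) '' {a : V × V | Γ.Adj a.1 a.2 ∧ ¬Γ.Adj a.2 a.1} := by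
      ext e
      induction e using Sym2.ind with
      | _ u w =>
        constructor
        · rintro (h | h)
          · exact ⟨(u, w), h, rfl⟩
          · exact ⟨(w, u), h, Sym2.eq_swap⟩
        · rintro ⟨⟨u', w'⟩, h, he⟩
          rcases Sym2.eq_iff.1 he with ⟨rfl, rfl⟩ | ⟨rfl, rfl⟩
          · exact Or.inl h
          · exact Or.inr h
    rw [himg, Set.InjOn.ncard_image]
    rintro ⟨u, w⟩ h ⟨u', w'⟩ h' he
    rcases Sym2.eq_iff.1 he with ⟨h1, h2⟩ | ⟨h1, h2⟩
    · exact Prod.ext h1 h2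
    · dsimp only at h1 h2
      subst h1 h2
      exact absurd h.1 h'.2
  have h2 := Γ.conicGraph.double.ncard_adj_eq_twice_ncard_edgeSet
  rw [ConicGraph.numEdges, ← h1, ← h2, ← Set.ncard_union_eq]
  · congr 1
    ext a
    change Γ.Adj _ _ ↔ (Γ.Adj _ _ ∧ ¬Γ.Adj _ _) ∨ (Γ.Adj _ _ ∧ Γ.Adj _ _)
    tauto
  · rw [Set.disjoint_left]
    rintro a h h'
    exact h.2 h'.2

theorem ConicGraph.exists_conicGraph_eq [Finite V] (T : ConicGraph V) :
    ∃ Γ : SimpleDigraph V, Γ.conicGraph = T := by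
  have := Fintype.ofFinite V
  let e := Fintype.equivFin V
  -- Double edges get both arcs; simple edges are oriented along an enumeration of the vertices.
  refine ⟨{ Adj := fun u w => T.double.Adj u w ∨ (T.simple.Adj u w ∧ e u < e w)
            loopless := fun u h => ?_ }, ?_⟩
  · rcases h with h | h
    · exact T.double.loopless.irrefl u h
    · exact T.simple.loopless.irrefl u h.1
  · have hdisj := SimpleGraph.disjoint_left.1 T.disjoint
    ext u w
    · have h1 := T.simple.adj_comm u w
      have h2 := T.double.adj_comm u w
      have h3 := hdisj u w
      have h4 : T.simple.Adj u w → e u < e w ∨ e w < e u := fun h =>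
        lt_or_gt_of_ne fun he => h.ne (e.injective he)
      have h5 : e u < e w → ¬ e w < e u := fun h => h.not_gt
      simp only [SimpleDigraph.conicGraph]
      tauto
    · have h1 := T.simple.adj_comm u w
      have h2 := T.double.adj_comm u w
      have h5 : e u < e w → ¬ e w < e u := fun h => h.not_gt
      simp only [SimpleDigraph.conicGraph]
      tauto

/-- Both summands are monotone under `IsSubgraph`, whereas the simple edges are not: halving a
double edge creates a new one. -/
theorem ConicGraph.numEdges_eq [Finite V] (T : ConicGraph V) :
    T.numEdges = (T.simple ⊔ T.double).edgeSet.ncard + T.double.edgeSet.ncard := by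
  rw [SimpleGraph.edgeSet_sup, Set.ncard_union_eq (by simpa using T.disjoint), numEdges]
  ring

theorem ConicGraph.IsSubgraph.eq_of_numEdges_le [Finite V] {T' T : ConicGraph V}
    (h : T'.IsSubgraph T) (hle : T.numEdges ≤ T'.numEdges) : T' = T := by
  have h1 := Set.ncard_le_ncard (SimpleGraph.edgeSet_mono h.1)
  have h2 := Set.ncard_le_ncard (SimpleGraph.edgeSet_mono h.2)
  rw [T.numEdges_eq, T'.numEdges_eq] at hle
  have e1 : T'.simple ⊔ T'.double = T.simple ⊔ T.double := SimpleGraph.edgeSet_inj.1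
    (Set.eq_of_subset_of_ncard_le (SimpleGraph.edgeSet_mono h.1) (by lia))
  have e2 : T'.double = T.double := SimpleGraph.edgeSet_inj.1
    (Set.eq_of_subset_of_ncard_le (SimpleGraph.edgeSet_mono h.2) (by lia))
  refine ConicGraph.ext ?_ e2
  rw [← T.disjoint.sup_sdiff_cancel_right, ← T'.disjoint.sup_sdiff_cancel_right, e1, e2]

end Graphs

theorem maxConicRank_eq {V : Type*} [Fintype V] [Nonempty V] (d : ℕ) :
    maxConicRank (Fintype.card V) d =
      maxEuclideanRank (Fintype.card V) d + (Fintype.card V - 1) := by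
  have : 0 < Fintype.card V := Fintype.card_pos
  unfold maxConicRank
  lia

/-! ### Splitting the conic rigidity matrix into two blocks -/

section Conic

variable {V : Type*} [DecidableEq V] {d : ℕ}

/-- The row of an arc in the Euclidean rigidity matrix, padded with zeros. -/
noncomputable def paddedEuclideanRow (x : V → EuclideanSpace ℝ (Fin d)) (a : V × V) :
    (V × Fin d) ⊕ V → ℝ :=
  Sum.elim (euclideanRow x a.1 a.2) 0

/-- The row of an arc in the incidence matrix, padded with zeros. -/
def paddedIncidenceRow (d : ℕ) (a : V × V) : (V × Fin d) ⊕ V → ℝ :=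
  Sum.elim 0 (incidenceRow a)

/-- This is the shape `a + t • b` required by the matroid union lemmas, with the length as weight.
-/
theorem conicRigidityMatrix_row (Γ : SimpleDigraph V) (p : V → EuclideanSpace ℝ (Fin d) × ℝ)
    (a : Γ.arcSet) : (conicRigidityMatrix Γ p).row a = paddedEuclideanRow (spatial p) a.1 +
      ‖spatial p a.1.1 - spatial p a.1.2‖ • paddedIncidenceRow d a.1 := by
  have h := biasRow_eq_smul (spatial p) a.1
  funext c
  rcases c with c | c
  · simp [conicRigidityMatrix, paddedEuclideanRow, paddedIncidenceRow, Matrix.row]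
  · simp [conicRigidityMatrix, paddedEuclideanRow, paddedIncidenceRow, Matrix.row, h]

theorem LinearIndependent.of_paddedEuclideanRow {ι : Type*} {x : V → EuclideanSpace ℝ (Fin d)}
    {a : ι → V × V} (h : LinearIndependent ℝ fun i => paddedEuclideanRow x (a i)) :
    LinearIndependent ℝ fun i => euclideanRow x (a i).1 (a i).2 := by
  let L : (V × Fin d → ℝ) →ₗ[ℝ] ((V × Fin d) ⊕ V → ℝ) :=
    (LinearEquiv.sumArrowLequivProdArrow (V × Fin d) V ℝ ℝ).symm.toLinearMap ∘ₗ LinearMap.inl ℝ _ _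
  exact LinearIndependent.of_comp L h

theorem LinearIndependent.of_paddedIncidenceRow {ι : Type*} {a : ι → V × V}
    (h : LinearIndependent ℝ fun i => paddedIncidenceRow d (a i)) :
    LinearIndependent ℝ fun i => incidenceRow (a i) := by
  let L : (V → ℝ) →ₗ[ℝ] ((V × Fin d) ⊕ V → ℝ) :=
    (LinearEquiv.sumArrowLequivProdArrow (V × Fin d) V ℝ ℝ).symm.toLinearMap ∘ₗ LinearMap.inr ℝ _ _
  exact LinearIndependent.of_comp L h

theorem LinearIndependent.sumElim_padded {ι κ : Type*} {x : V → EuclideanSpace ℝ (Fin d)}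
    {a : ι → V × V} {b : κ → V × V}
    (ha : LinearIndependent ℝ fun i => euclideanRow x (a i).1 (a i).2)
    (hb : LinearIndependent ℝ fun i => incidenceRow (b i)) :
    LinearIndependent ℝ (Sum.elim (fun i => paddedEuclideanRow x (a i))
      fun i => paddedIncidenceRow d (b i)) := by
  have h := (linearIndependent_inl_union_inr' ha hb).map'
    (LinearEquiv.sumArrowLequivProdArrow (V × Fin d) V ℝ ℝ).symm.toLinearMap
    (LinearEquiv.ker _)
  have hrow : Sum.elim (fun i => paddedEuclideanRow x (a i)) (fun i => paddedIncidenceRow d (b i)) =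
      (LinearEquiv.sumArrowLequivProdArrow (V × Fin d) V ℝ ℝ).symm.toLinearMap ∘
        Sum.elim (LinearMap.inl ℝ _ _ ∘ fun i => euclideanRow x (a i).1 (a i).2)
          (LinearMap.inr ℝ _ _ ∘ fun i => incidenceRow (b i)) := by
    funext i
    rcases i with i | i <;> rfl
  rw [hrow]
  exact h

variable [Fintype V]

/-- The rank of conic rigidity matrices at generic configurations is at most `maxConicRank`. -/
theorem conicRigidityMatrix_rank_le [Nonempty V] (Γ : SimpleDigraph V)
    {p : V → EuclideanSpace ℝ (Fin d) × ℝ} (hx : IsGeneric (spatial p)) :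
    (conicRigidityMatrix Γ p).rank ≤ maxConicRank (Fintype.card V) d := by
  let L : (V × Fin d → ℝ) × (V → ℝ) →ₗ[ℝ] ((V × Fin d) ⊕ V → ℝ) :=
    (LinearEquiv.sumArrowLequivProdArrow (V × Fin d) V ℝ ℝ).symm.toLinearMap
  rw [Matrix.rank_eq_finrank_span_row, maxConicRank_eq]
  have hle : Submodule.span ℝ (Set.range (conicRigidityMatrix Γ p).row) ≤
      (Submodule.span ℝ (Set.range fun a : V × V => euclideanRow (spatial p) a.1 a.2)).map
        (L ∘ₗ LinearMap.inl ℝ _ _) ⊔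
      (Submodule.span ℝ (Set.range fun a : V × V => incidenceRow a)).map
        (L ∘ₗ LinearMap.inr ℝ _ _) := by
    rw [Submodule.span_le]
    rintro _ ⟨a, rfl⟩
    rw [conicRigidityMatrix_row]
    exact Submodule.add_mem_sup
      (Submodule.mem_map_of_mem (f := L ∘ₗ LinearMap.inl ℝ _ _)
        (Submodule.subset_span ⟨a.1, rfl⟩))
      (Submodule.smul_mem _ _ (Submodule.mem_map_of_mem (f := L ∘ₗ LinearMap.inr ℝ _ _)
        (Submodule.subset_span ⟨a.1, rfl⟩)))
  refine (Submodule.finrank_mono hle).trans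
    ((Submodule.finrank_add_le_finrank_add_finrank _ _).trans (Nat.add_le_add ?_ ?_))
  · exact (Submodule.finrank_map_le _ _).trans (finrank_span_euclideanRow_le hx fun a => a)
  · exact (Submodule.finrank_map_le _ _).trans (finrank_span_incidenceRow_le fun a => a)

end Conic

/-! ### From conic rigidity to a decomposition -/

section Main

universe u

variable {V : Type u} [Fintype V] [DecidableEq V] {d : ℕ}

/-- Enough independent rows at a single configuration suffice, since independence passes to all
generic ones and the rank cannot exceed the maximum. -/
theorem isRigidEuclidean_of_linearIndependent {G : SimpleGraph V} {ι : Type*} [Fintype ι]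
    {a : ι → V × V} (ha : ∀ i, G.Adj (a i).1 (a i).2) {x : V → EuclideanSpace ℝ (Fin d)}
    (hli : LinearIndependent ℝ fun i => euclideanRow x (a i).1 (a i).2)
    (hcard : maxEuclideanRank (Fintype.card V) d ≤ Fintype.card ι) : IsRigidEuclidean d G := by
  intro y hy
  refine le_antisymm ?_ ?_
  · rw [Matrix.rank_eq_finrank_span_row]
    refine le_trans (Submodule.finrank_mono (Submodule.span_mono ?_))
      (finrank_span_euclideanRow_le hy fun b : V × V => b)
    rintro _ ⟨⟨e, he⟩, rfl⟩
    induction e using Sym2.ind with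
    | _ u w => exact ⟨(u, w), rfl⟩
  · rw [Matrix.rank_eq_finrank_span_row]
    refine hcard.trans ?_
    rw [linearIndependent_iff_card_eq_finrank_span.1 (hli.euclideanRow_of_isGeneric hy)]
    refine Submodule.finrank_mono (Submodule.span_mono ?_)
    rintro _ ⟨i, rfl⟩
    exact ⟨⟨s((a i).1, (a i).2), ha i⟩, rfl⟩

/-- The set `P` offers at least one orientation of each edge of $G$, which is all that is available
when the arcs come from a given digraph. -/
theorem IsRigidEuclidean.exists_linearIndependent {G : SimpleGraph V} (hG : IsRigidEuclidean d G)
    {x : V → EuclideanSpace ℝ (Fin d)} (hx : IsGeneric x) {P : Set (V × V)}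
    (hP : ∀ u w, G.Adj u w → (u, w) ∈ P ∨ (w, u) ∈ P) :
    ∃ (κ : Type u) (_ : Fintype κ) (a : κ → P),
      (LinearIndependent ℝ fun k => euclideanRow x (a k).1.1 (a k).1.2) ∧
      maxEuclideanRank (Fintype.card V) d ≤ Fintype.card κ := by
  obtain ⟨κ, a, ha, hspan, hli⟩ :=
    exists_linearIndependent' ℝ fun b : P => euclideanRow x b.1.1 b.1.2
  have := Finite.of_injective a ha
  have hκ := Fintype.ofFinite κ
  refine ⟨κ, hκ, a, hli, ?_⟩
  rw [linearIndependent_iff_card_eq_finrank_span.1 hli, ← hG x hx,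
    Matrix.rank_eq_finrank_span_row, Set.finrank, hspan]
  refine Submodule.finrank_mono (Submodule.span_mono ?_)
  rintro _ ⟨⟨e, he⟩, rfl⟩
  induction e using Sym2.ind with
  | _ u w =>
    rcases hP u w he with h | h
    · exact ⟨⟨(u, w), h⟩, rfl⟩
    · exact ⟨⟨(w, u), h⟩, euclideanRow_comm x w u⟩

theorem SimpleGraph.Connected.exists_linearIndependent_incidenceRow {H : SimpleGraph V}
    (hH : H.Connected) {P : Set (V × V)} (hP : ∀ u w, H.Adj u w → (u, w) ∈ P ∨ (w, u) ∈ P) :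
    ∃ (κ : Type u) (_ : Fintype κ) (a : κ → P), Function.Injective a ∧
      (LinearIndependent ℝ fun k => incidenceRow (a k).1) ∧
      Fintype.card V - 1 ≤ Fintype.card κ := by
  obtain ⟨κ, a, ha, hspan, hli⟩ := exists_linearIndependent' ℝ fun b : P => incidenceRow b.1
  have := Finite.of_injective a ha
  have hκ := Fintype.ofFinite κ
  refine ⟨κ, hκ, a, ha, hli, ?_⟩
  rw [linearIndependent_iff_card_eq_finrank_span.1 hli, Set.finrank, hspan]
  refine card_sub_one_le_finrank_span_incidenceRow (fun b : P => b.1) hH fun u w huw => ?_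
  rcases hP u w huw with h | h
  · exact ⟨⟨_, h⟩, Or.inl rfl⟩
  · exact ⟨⟨_, h⟩, Or.inr rfl⟩

/-- A conic graph with one infinitesimally rigid generic framework has a decomposition. -/
theorem SimpleDigraph.exists_isDecomposition [Nonempty V] (Γ : SimpleDigraph V)
    {p : V → EuclideanSpace ℝ (Fin d) × ℝ} (hx : IsGeneric (spatial p))
    (hrank : IsInfinitesimallyRigidConic Γ p) :
    ∃ G H : SimpleGraph V, Γ.conicGraph.IsDecomposition G H ∧ IsRigidEuclidean d G ∧
      H.Connected := by
  classical
  obtain ⟨κ, a, ha, hspan, hli⟩ := exists_linearIndependent' ℝ (conicRigidityMatrix Γ p).row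
  have := Finite.of_injective a ha
  have hκ := Fintype.ofFinite κ
  have hcard : Fintype.card κ =
      maxEuclideanRank (Fintype.card V) d + (Fintype.card V - 1) := by
    rw [linearIndependent_iff_card_eq_finrank_span.1 hli, Set.finrank, hspan,
      ← Matrix.rank_eq_finrank_span_row, hrank, maxConicRank_eq]
  have hrow : (conicRigidityMatrix Γ p).row ∘ a = fun k =>
      paddedEuclideanRow (spatial p) (a k).1 +
        ‖spatial p (a k).1.1 - spatial p (a k).1.2‖ • paddedIncidenceRow d (a k).1 :=
    funext fun k => conicRigidityMatrix_row Γ p (a k)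
  rw [hrow] at hli
  obtain ⟨S, hS⟩ := hli.exists_piecewise_of_add_smul
  have hE : LinearIndependent ℝ fun k : {k // k ∉ S} =>
      euclideanRow (spatial p) (a k).1.1 (a k).1.2 := by
    refine LinearIndependent.of_paddedEuclideanRow (a := fun k : {k // k ∉ S} => (a k).1) ?_
    have h := hS.comp (Subtype.val : {k // k ∉ S} → κ) Subtype.val_injective
    have hfun : S.piecewise (fun k => paddedIncidenceRow d (a k).1)
        (fun k => paddedEuclideanRow (spatial p) (a k).1) ∘ (Subtype.val : {k // k ∉ S} → κ) =
        fun k : {k // k ∉ S} => paddedEuclideanRow (spatial p) (a k).1 := by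
      funext k
      simp [k.2]
    rwa [hfun] at h
  have hB : LinearIndependent ℝ fun k : {k // k ∈ S} => incidenceRow (a k).1 := by
    refine LinearIndependent.of_paddedIncidenceRow (d := d)
      (a := fun k : {k // k ∈ S} => (a k).1) ?_
    have h := hS.comp (Subtype.val : {k // k ∈ S} → κ) Subtype.val_injective
    have hfun : S.piecewise (fun k => paddedIncidenceRow d (a k).1)
        (fun k => paddedEuclideanRow (spatial p) (a k).1) ∘ (Subtype.val : {k // k ∈ S} → κ) =
        fun k : {k // k ∈ S} => paddedIncidenceRow d (a k).1 := by
      funext k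
      simp [k.2]
    rwa [hfun] at h
  -- The two parts have at most $S_e$ and $n-1$ elements and together exactly $S_e+n-1$, so both
  -- bounds are attained.
  have hcE := finrank_span_euclideanRow_le hx fun k : {k // k ∉ S} => (a k).1
  have hcE' := linearIndependent_iff_card_eq_finrank_span.1 hE
  have hcB := finrank_span_incidenceRow_le fun k : {k // k ∈ S} => (a k).1
  have hcB' := linearIndependent_iff_card_eq_finrank_span.1 hB
  rw [Set.finrank] at hcE' hcB'
  have hsum := Fintype.card_subtype_compl fun k => k ∈ S
  have hsub := Fintype.card_subtype_le fun k => k ∈ S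
  let P : Set (V × V) := {b | ∃ k, k ∉ S ∧ (a k).1 = b}
  let Q : Set (V × V) := {b | ∃ k, k ∈ S ∧ (a k).1 = b}
  have hPΓ : ∀ u w, (u, w) ∈ P → Γ.Adj u w := by
    rintro u w ⟨k, -, hk⟩
    have := (a k).2
    rw [hk] at this
    exact this
  have hQΓ : ∀ u w, (u, w) ∈ Q → Γ.Adj u w := by
    rintro u w ⟨k, -, hk⟩
    have := (a k).2
    rw [hk] at this
    exact this
  have hPQ : ∀ b, b ∈ P → b ∉ Q := by
    rintro b ⟨k, hk, hkb⟩ ⟨k', hk', hkb'⟩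
    exact hk (ha (Subtype.ext (hkb.trans hkb'.symm)) ▸ hk')
  have hne : ∀ b : Γ.arcSet, b.1.1 ≠ b.1.2 := by
    rintro ⟨⟨u, w⟩, h⟩ (rfl : u = w)
    exact Γ.loopless u h
  let T := Γ.conicGraph
  let F := SimpleGraph.fromRel fun u w => (u, w) ∈ P
  let F' := SimpleGraph.fromRel fun u w => (u, w) ∈ Q
  -- Edges unused by the basis must be placed too: double edges belong to both graphs, and simple
  -- edges outside `F'` are given to $G$. Enlarging either graph does no harm.
  refine ⟨F ⊔ T.double ⊔ (T.simple \ F'), F' ⊔ T.double, ?_, ?_, ?_⟩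
  · have hirr := Γ.loopless
    unfold ConicGraph.IsDecomposition
    ext u w
    · have h1 := hPΓ u w
      have h2 := hPΓ w u
      have h3 := hQΓ u w
      have h4 := hQΓ w u
      have h5 := hPQ (u, w)
      have h6 := hPQ (w, u)
      have h7 : Γ.Adj u w → u ≠ w := fun h e => hirr u (by rw [← e] at h; exact h)
      have h8 : Γ.Adj w u → u ≠ w := fun h e => hirr u (by rw [← e] at h; exact h)
      simp only [ConicGraph.union, symmDiff, F, F', T, SimpleGraph.sup_adj, SimpleGraph.sdiff_adj,
        SimpleGraph.fromRel_adj, SimpleDigraph.conicGraph]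
      grind
    · have h1 := hPΓ u w
      have h2 := hPΓ w u
      have h3 := hQΓ u w
      have h4 := hQΓ w u
      have h5 := hPQ (u, w)
      have h6 := hPQ (w, u)
      simp only [ConicGraph.union, F, F', T, SimpleGraph.sup_adj, SimpleGraph.sdiff_adj,
        SimpleGraph.inf_adj, SimpleGraph.fromRel_adj, SimpleDigraph.conicGraph]
      grind
  · refine isRigidEuclidean_of_linearIndependent (a := fun k : {k // k ∉ S} => (a k).1)
      (fun k => ?_) hE (by lia)
    exact Or.inl (Or.inl ((SimpleGraph.fromRel_adj _ _ _).2 ⟨hne _, Or.inl ⟨k, k.2, rfl⟩⟩))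
  · refine connected_of_card_sub_one_le_finrank (fun k : {k // k ∈ S} => (a k).1)
      (fun k => ?_) (by lia)
    exact Or.inl ((SimpleGraph.fromRel_adj _ _ _).2 ⟨hne _, Or.inl ⟨k, k.2, rfl⟩⟩)

end Main

/-! ### From a decomposition to conic rigidity -/

theorem IsGeneric.norm_sub_ne_zero {V : Type*} [Finite V] {d : ℕ} (hd : 2 ≤ d) {x : V → EuclideanSpace ℝ (Fin d)}
    (hx : IsGeneric x) {u w : V} (h : u ≠ w) : ‖x u - x w‖ ≠ 0 := by
  intro h0
  have h1 := aeval_sqDistPoly x u w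
  rw [h0, zero_pow two_ne_zero] at h1
  -- The case of one factor and the square of $0$: the squared distance is not the zero polynomial.
  refine prod_sqDistPoly_ne_sq hd {()} (by simp) (fun _ => u) (fun _ => w) (fun _ _ => h)
    (by simp [Set.InjOn]) 0 ?_
  simpa using hx _ h1

section Sufficiency

universe u

variable {V : Type u} [DecidableEq V] {d : ℕ}

theorem paddedEuclideanRow_mem {x : V → EuclideanSpace ℝ (Fin d)} (a : V × V)
    (c : (V × Fin d) ⊕ V) : paddedEuclideanRow x a c ∈ coordRing x := by
  rcases c with c | c
  · exact mem_coordRing.2 ⟨_, aeval_euclideanRowPoly x a c⟩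
  · exact (coordRing x).zero_mem

theorem paddedIncidenceRow_mem (R : Subring ℝ) (a : V × V) (c : (V × Fin d) ⊕ V) :
    paddedIncidenceRow d a c ∈ R := by
  rcases c with c | c
  · exact R.zero_mem
  · change (Pi.single a.2 1 - Pi.single a.1 1 : V → ℝ) c ∈ R
    simp only [Pi.sub_apply, Pi.single_apply]
    refine R.sub_mem ?_ ?_ <;> split_ifs
    exacts [R.one_mem, R.zero_mem, R.one_mem, R.zero_mem]

variable [Fintype V]

/-- All generic frameworks on the union of a rigid and a connected graph are infinitesimally
rigid. -/
theorem ConicGraph.IsDecomposition.isRigid [Nonempty V] (hd : 2 ≤ d) {T : ConicGraph V}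
    {G H : SimpleGraph V} (hT : T.IsDecomposition G H) (hG : IsRigidEuclidean d G)
    (hH : H.Connected) : T.IsRigid d := by
  classical
  intro Γ p hΓ hx
  refine le_antisymm (conicRigidityMatrix_rank_le Γ hx) ?_
  have hT' : Γ.conicGraph = ConicGraph.union G H := hΓ.trans hT
  have hsimple : ∀ u w, (Γ.Adj u w ∧ ¬Γ.Adj w u) ∨ (Γ.Adj w u ∧ ¬Γ.Adj u w) ↔
      (G.Adj u w ∧ ¬H.Adj u w) ∨ (H.Adj u w ∧ ¬G.Adj u w) := fun u w =>
    Iff.of_eq (congrArg (fun T : ConicGraph V => T.simple.Adj u w) hT')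
  have hdouble : ∀ u w, (Γ.Adj u w ∧ Γ.Adj w u) ↔ (G.Adj u w ∧ H.Adj u w) := fun u w =>
    Iff.of_eq (congrArg (fun T : ConicGraph V => T.double.Adj u w) hT')
  obtain ⟨κ, _, a, ha, hκ⟩ := hG.exists_linearIndependent hx
    (P := {b | Γ.Adj b.1 b.2 ∧ G.Adj b.1 b.2}) (by
      intro u w h
      have h1 := hsimple u w
      have h2 := hdouble u w
      have h3 := h.symm
      simp only [Set.mem_ofPred_eq]
      tauto)
  obtain ⟨κ', _, b, hbinj, hb, hκ'⟩ := hH.exists_linearIndependent_incidenceRow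
    (P := {b | Γ.Adj b.1 b.2 ∧ H.Adj b.1 b.2}) (by
      intro u w h
      have h1 := hsimple u w
      have h2 := hdouble u w
      have h3 := h.symm
      simp only [Set.mem_ofPred_eq]
      tauto)
  set x := spatial p with hxdef
  -- Indices in `D` belong to simple edges and will carry the conic row $A+tB$. The others belong to
  -- double edges and carry just the Euclidean row (left) or the incidence row (right). The set `S`
  -- is chosen so that `S.piecewise B A` is the independent family of Euclidean rows on `κ` and
  -- incidence rows on `κ'`.
  let A : κ ⊕ κ' → (V × Fin d) ⊕ V → ℝ := Sum.elim (fun k => paddedEuclideanRow x (a k).1)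
    fun k => if G.Adj (b k).1.1 (b k).1.2 then paddedIncidenceRow d (b k).1
      else paddedEuclideanRow x (b k).1
  let pair : κ ⊕ κ' → V × V := Sum.elim (fun k => (a k).1) fun k => (b k).1
  let B : κ ⊕ κ' → (V × Fin d) ⊕ V → ℝ := fun i => paddedIncidenceRow d (pair i)
  let S : Finset (κ ⊕ κ') := {i | i.isRight ∧ ¬G.Adj (pair i).1 (pair i).2}
  let D : Finset (κ ⊕ κ') :=
    {i | ¬(G.Adj (pair i).1 (pair i).2 ∧ H.Adj (pair i).1 (pair i).2)}
  have haΓ : ∀ k, Γ.Adj (a k).1.1 (a k).1.2 := fun k => (a k).2.1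
  have haG : ∀ k, G.Adj (a k).1.1 (a k).1.2 := fun k => (a k).2.2
  have hbΓ : ∀ k, Γ.Adj (b k).1.1 (b k).1.2 := fun k => (b k).2.1
  have hbH : ∀ k, H.Adj (b k).1.1 (b k).1.2 := fun k => (b k).2.2
  have hpairΓ : ∀ i, Γ.Adj (pair i).1 (pair i).2 := by
    rintro (k | k)
    exacts [haΓ k, hbΓ k]
  have hne : ∀ i, (pair i).1 ≠ (pair i).2 := fun i h =>
    Γ.loopless (pair i).1 (by have := hpairΓ i; rwa [← h] at this)
  have hSD : S ⊆ D := by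
    intro i
    simp only [S, D, Finset.mem_filter, Finset.mem_univ, true_and]
    tauto
  -- Distinct indices in `D` have distinct edges, hence distinct weights as the expansion requires:
  -- an edge chosen on both sides lies in $G\cap H$, and a repetition on one side would give equal
  -- or opposite rows in an independent family.
  have hinj : Set.InjOn (fun i => s((pair i).1, (pair i).2)) D := by
    have hmix : ∀ k k', Sum.inl k ∈ D → s((a k).1.1, (a k).1.2) ≠ s((b k').1.1, (b k').1.2) := by
      intro k k' hk he
      have h1 : ¬(G.Adj (a k).1.1 (a k).1.2 ∧ H.Adj (a k).1.1 (a k).1.2) :=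
        (Finset.mem_filter.1 hk).2
      refine h1 ⟨haG k, ?_⟩
      rw [← SimpleGraph.mem_edgeSet, he]
      exact hbH k'
    rintro (k | k) hi (k' | k') hi' he
    · refine congrArg Sum.inl (ha.injective ?_)
      rcases Sym2.eq_iff.1 he with ⟨h1, h2⟩ | ⟨h1, h2⟩
      · change (a k).1.1 = (a k').1.1 at h1
        change (a k).1.2 = (a k').1.2 at h2
        simp only [h1, h2]
      · change (a k).1.1 = (a k').1.2 at h1
        change (a k).1.2 = (a k').1.1 at h2
        simp only [h1, h2]
        exact euclideanRow_comm _ _ _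
    · exact absurd he (hmix k k' hi)
    · exact absurd he.symm (hmix k' k hi')
    · refine congrArg Sum.inr ?_
      rcases Sym2.eq_iff.1 he with ⟨h1, h2⟩ | ⟨h1, h2⟩
      · exact hbinj (Subtype.ext (Prod.ext h1 h2))
      · by_contra hkk
        have hswap : (b k).1 = (b k').1.swap := Prod.ext h1 h2
        refine hb.notMem_span_image (s := {k'}) (x := k) hkk ?_
        rw [Set.image_singleton, Submodule.mem_span_singleton]
        exact ⟨-1, by rw [hswap, incidenceRow_swap, neg_one_smul]⟩
  have hpiece : S.piecewise B A = Sum.elim (fun k => paddedEuclideanRow x (a k).1)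
      fun k => paddedIncidenceRow d (b k).1 := by
    funext i
    rcases i with k | k
    · simp [S, A]
    · by_cases h : G.Adj (b k).1.1 (b k).1.2 <;> simp [S, A, B, pair, h]
  have hli := LinearIndependent.ite_add_smul_of_piecewise (coordRing x) D
    (fun i => ‖x (pair i).1 - x (pair i).2‖)
    (hx.sum_mul_prod_dist_eq_zero hd D (fun i => (pair i).1) (fun i => (pair i).2)
      (fun i _ => hne i) hinj)
    (a := A) (b := B)
    (by
      rintro (k | k) c
      · exact paddedEuclideanRow_mem _ c
      · by_cases h : G.Adj (b k).1.1 (b k).1.2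
        · simpa [A, h] using paddedIncidenceRow_mem _ _ c
        · simpa [A, h] using paddedEuclideanRow_mem _ c)
    (fun i c => paddedIncidenceRow_mem _ _ c) hSD
    (by rw [hpiece]; exact ha.sumElim_padded hb)
  have hcard := linearIndependent_iff_card_eq_finrank_span.1 hli
  rw [Fintype.card_sum, Set.finrank] at hcard
  rw [maxConicRank_eq, Matrix.rank_eq_finrank_span_row]
  refine (Nat.add_le_add hκ hκ').trans (hcard.le.trans (Submodule.finrank_mono ?_))
  have hrow : ∀ c : V × V, Γ.Adj c.1 c.2 →
      paddedEuclideanRow x c + ‖x c.1 - x c.2‖ • paddedIncidenceRow d c ∈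
        Submodule.span ℝ (Set.range (conicRigidityMatrix Γ p).row) := fun c hc =>
    Submodule.subset_span ⟨⟨c, hc⟩, conicRigidityMatrix_row Γ p ⟨c, hc⟩⟩
  have hrow' : ∀ c : V × V, Γ.Adj c.2 c.1 →
      paddedEuclideanRow x c - ‖x c.1 - x c.2‖ • paddedIncidenceRow d c ∈
        Submodule.span ℝ (Set.range (conicRigidityMatrix Γ p).row) := by
    intro c hc
    have h := hrow c.swap hc
    have h1 : paddedEuclideanRow x c.swap = paddedEuclideanRow x c :=
      congrArg (fun r => (Sum.elim r 0 : (V × Fin d) ⊕ V → ℝ)) (euclideanRow_comm x c.2 c.1)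
    have h2 : paddedIncidenceRow d c.swap = -paddedIncidenceRow d c := by
      funext k
      rcases k with k | k <;> simp [paddedIncidenceRow, incidenceRow_swap]
    rw [h1, h2, smul_neg, ← sub_eq_add_neg, Prod.fst_swap, Prod.snd_swap, norm_sub_rev] at h
    exact h
  -- Opposite arcs have rows $E+tB$ and $E-tB$; half their sum and half their difference, divided by
  -- $t\ne0$, recover $E$ and $B$.
  have hboth : ∀ c : V × V, Γ.Adj c.1 c.2 → Γ.Adj c.2 c.1 →
      paddedEuclideanRow x c ∈ Submodule.span ℝ (Set.range (conicRigidityMatrix Γ p).row) ∧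
      paddedIncidenceRow d c ∈ Submodule.span ℝ (Set.range (conicRigidityMatrix Γ p).row) := by
    intro c h1 h2
    have hc : c.1 ≠ c.2 := fun h => Γ.loopless c.1 (by rwa [← h] at h1)
    have hnorm := hx.norm_sub_ne_zero hd hc
    constructor
    · have := Submodule.smul_mem _ (1 / 2 : ℝ) (Submodule.add_mem _ (hrow c h1) (hrow' c h2))
      convert this using 1
      module
    · have := Submodule.smul_mem _ (1 / 2 * ‖x c.1 - x c.2‖⁻¹ : ℝ)
        (Submodule.sub_mem _ (hrow c h1) (hrow' c h2))
      convert this using 1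
      rw [add_sub_sub_cancel, ← two_smul ℝ, smul_smul, smul_smul]
      field_simp
      rw [one_smul]
  rw [Submodule.span_le]
  rintro _ ⟨i, rfl⟩
  by_cases hi : i ∈ D
  · simp only [hi, if_true]
    have hAi : A i = paddedEuclideanRow x (pair i) := by
      rcases i with k | k
      · rfl
      · have h : ¬(G.Adj (b k).1.1 (b k).1.2 ∧ H.Adj (b k).1.1 (b k).1.2) :=
          (Finset.mem_filter.1 hi).2
        have : ¬G.Adj (b k).1.1 (b k).1.2 := fun h' => h ⟨h', hbH k⟩
        simp [A, pair, this]
    rw [hAi]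
    exact hrow _ (hpairΓ i)
  · simp only [hi, if_false]
    have h : G.Adj (pair i).1 (pair i).2 ∧ H.Adj (pair i).1 (pair i).2 := by
      by_contra h
      exact hi (Finset.mem_filter.2 ⟨Finset.mem_univ _, h⟩)
    obtain ⟨h1, h2⟩ := (hdouble _ _).2 h
    have hmem := hboth _ h1 h2
    rcases i with k | k
    · exact hmem.1
    · have hG' : G.Adj (b k).1.1 (b k).1.2 := h.1
      have : A (Sum.inr k) = paddedIncidenceRow d (b k).1 := by simp [A, hG']
      rw [this]
      exact hmem.2

/-! ### Edge counts and minimal rigidity -/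

/-- Rigid conic graphs have at least `maxConicRank` edges. -/
theorem ConicGraph.IsRigid.maxConicRank_le_numEdges {T : ConicGraph V} (hT : T.IsRigid d) :
    maxConicRank (Fintype.card V) d ≤ T.numEdges := by
  classical
  obtain ⟨x, hx⟩ := exists_isGeneric V d
  obtain ⟨Γ, rfl⟩ := T.exists_conicGraph_eq
  -- The biases do not enter the matrix, so they are set to zero.
  rw [← Γ.ncard_arcSet, ← hT Γ (fun u => (x u, 0)) rfl hx, ← Nat.card_coe_set_eq,
    Nat.card_eq_fintype_card]
  exact Matrix.rank_le_card_height _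

/-- The forward direction uses only one generic framework with one orientation, so rigidity there
already implies rigidity of all of them. -/
theorem ConicGraph.isRigid_iff_exists_isDecomposition [Nonempty V] (hd : 2 ≤ d)
    (T : ConicGraph V) :
    T.IsRigid d ↔
      ∃ G H : SimpleGraph V, T.IsDecomposition G H ∧ IsRigidEuclidean d G ∧ H.Connected := by
  constructor
  · intro hT
    obtain ⟨x, hx⟩ := exists_isGeneric V d
    obtain ⟨Γ, rfl⟩ := T.exists_conicGraph_eq
    exact Γ.exists_isDecomposition (p := fun u => (x u, 0)) hx (hT Γ _ rfl hx)
  · rintro ⟨G, H, hT, hG, hH⟩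
    exact hT.isRigid hd hG hH

/-- Rigid conic graphs have rigid subgraphs with `maxConicRank` edges. -/
theorem ConicGraph.IsRigid.exists_isSubgraph [Nonempty V] (hd : 2 ≤ d) {T : ConicGraph V}
    (hT : T.IsRigid d) : ∃ T' : ConicGraph V, T'.IsSubgraph T ∧ T'.IsRigid d ∧
      T'.numEdges = maxConicRank (Fintype.card V) d := by
  classical
  obtain ⟨x, hx⟩ := exists_isGeneric V d
  obtain ⟨Γ, rfl⟩ := T.exists_conicGraph_eq
  let p : V → EuclideanSpace ℝ (Fin d) × ℝ := fun u => (x u, 0)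
  have hrank := hT Γ p rfl hx
  obtain ⟨κ, a, ha, hspan, hli⟩ := exists_linearIndependent' ℝ (conicRigidityMatrix Γ p).row
  have := Finite.of_injective a ha
  have hκ := Fintype.ofFinite κ
  have hcard : Fintype.card κ = maxConicRank (Fintype.card V) d := by
    rw [linearIndependent_iff_card_eq_finrank_span.1 hli, Set.finrank, hspan,
      ← Matrix.rank_eq_finrank_span_row, hrank]
  let Γ' : SimpleDigraph V :=
    { Adj := fun u w => ∃ k, (a k).1 = (u, w)
      loopless := by
        rintro u ⟨k, hk⟩
        have := (a k).2
        rw [hk] at this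
        exact Γ.loopless u this }
  have hsub : ∀ u w, Γ'.Adj u w → Γ.Adj u w := by
    rintro u w ⟨k, hk⟩
    have := (a k).2
    rwa [hk] at this
  have hrange : Γ'.arcSet = Set.range (Subtype.val ∘ a) := Set.ext fun _ => Iff.rfl
  refine ⟨Γ'.conicGraph, ⟨?_, fun u w h => ⟨hsub _ _ h.1, hsub _ _ h.2⟩⟩, ?_, ?_⟩
  · intro u w h
    have h1 := hsub u w
    have h2 := hsub w u
    simp only [SimpleGraph.sup_adj, SimpleDigraph.conicGraph] at h ⊢
    tauto
  -- The basis rows give full rank only at this `p` and this orientation; the decomposition carries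
  -- rigidity over to all generic frameworks.
  · rw [ConicGraph.isRigid_iff_exists_isDecomposition hd]
    refine Γ'.exists_isDecomposition (p := p) hx (le_antisymm (conicRigidityMatrix_rank_le _ hx) ?_)
    rw [← hrank, Matrix.rank_eq_finrank_span_row, Matrix.rank_eq_finrank_span_row, ← hspan]
    refine Submodule.finrank_mono (Submodule.span_mono ?_)
    rintro _ ⟨k, rfl⟩
    refine ⟨⟨(a k).1, k, rfl⟩, ?_⟩
    rw [Function.comp_apply, conicRigidityMatrix_row, conicRigidityMatrix_row]
  · rw [← Γ'.ncard_arcSet, hrange, ← hcard, ← Set.image_univ, Set.InjOn.ncard_image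
      (Subtype.val_injective.comp ha).injOn, Set.ncard_univ, Nat.card_eq_fintype_card]

end Sufficiency

theorem theorem3 {V : Type*} [Fintype V] [DecidableEq V] [Nonempty V] (d : ℕ) (hd : 2 ≤ d)
    (T : ConicGraph V) :
    (T.IsRigid d ↔
      ∃ G H : SimpleGraph V, T.IsDecomposition G H ∧ IsRigidEuclidean d G ∧ H.Connected) ∧
    (T.IsMinimallyRigid d ↔
      T.IsIndependent d ∧ T.numEdges = maxEuclideanRank (Fintype.card V) d + Fintype.card V - 1) := by
  classical
  refine ⟨T.isRigid_iff_exists_isDecomposition hd, ?_, ?_⟩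
  · rintro ⟨hT, hmin⟩
    obtain ⟨T', hsub, hT', hcard⟩ := hT.exists_isSubgraph hd
    obtain rfl := hmin T' hsub hT'
    refine ⟨fun Γ p hΓ hx => ?_, hcard⟩
    have hrank : (conicRigidityMatrix Γ p).rank = _ := hT Γ p hΓ hx
    -- Rank equals the number of rows, as the number of arcs is the number of edges.
    rw [linearIndependent_iff_card_eq_finrank_span, Set.finrank,
      ← Matrix.rank_eq_finrank_span_row, hrank, ← hcard, ← hΓ, ← Γ.ncard_arcSet,
      ← Nat.card_coe_set_eq, Nat.card_eq_fintype_card]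
  · rintro ⟨hT, hcard⟩
    -- A rigid subgraph has at least as many edges as the maximal rank, hence as $T$, so nothing was
    -- removed.
    refine ⟨fun Γ p hΓ hx => ?_, fun T' hsub hT' =>
      hsub.eq_of_numEdges_le (hcard.trans_le hT'.maxConicRank_le_numEdges)⟩
    change (conicRigidityMatrix Γ p).rank = _
    rw [LinearIndependent.rank_matrix (hT Γ p hΓ hx), maxConicRank, ← hcard, ← hΓ,
      ← Γ.ncard_arcSet, ← Nat.card_coe_set_eq, Nat.card_eq_fintype_card]
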